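/- **Setting.** Let $d,k,n_s\ge 1$. Consider the Markovian jump linear system $x_{t+1}=A_{\omega(t)}x_t+B_{\omega(t)}u_t$ with $x_t\in\mathbb R^d$, $u_t\in\mathbb R^k$, where $\omega(t)$ is a Markov chain on $\Omega=\{1,\dots,n_s\}$ with transition probabilities $p_{ij}$ and initial distribution $\rho$ with $\rho_i>0$ for all $i$. The random initial state $x_0$ is independent of the chain, has finite second moment, and satisfies $\mathbb E[x_0x_0^T]\succ0$. Let $Q_i\succ0$, $R_i\succ0$ for all $i\in\Omega$. For a gain $\hat K=[K_1\ \cdots\ K_{n_s}]$ with $K_i\in\mathbb R^{k\times d}$, apply $u_t=-K_{\omega(t)}x_t$ and put $$C(\hat K)=\mathbb E\Big[\sum_{t\ge0}x_t^TQ_{\omega(t)}x_t+u_t^TR_{\omega(t)}u_t\Big].$$ Let $\mathcal K$ be the set of gains that stabilize the system in the mean-square sense ($\mathbb E\|x_t\|^2\to0$ for every initial state with finite second moment that is independent of the chain, and every initial mode distribution). Write $\mathcal E_i(P)=\sum_jp_{ij}P_j$, let $P^{\hat K}$ be the solution of the coupled Lyapunov equations $P_i=Q_i+K_i^TR_iK_i+(A_i-B_iK_i)^T\mathcal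 E_i(P)(A_i-B_iK_i)$, and put $$\Psi_i(\hat K)=R_i+B_i^T\mathcal E_i(P^{\hat K})B_i,\qquad L_i(\hat K)=\Psi_i(\hat K)K_i-B_i^T\mathcal E_i(P^{\hat K})A_i,$$ $$\chi_{\hat K}=\mathrm{diag}\Big(\sum_{t\ge0}X_1(t),\dots,\sum_{t\ge0}X_{n_s}(t)\Big),\qquad X_i(t)=\mathbb E[x_tx_t^T\mathbf 1\{\omega(t)=i\}].$$ Let $\hat R=\mathrm{diag}(R_1,\dots,R_{n_s})$, $\hat B=\mathrm{diag}(B_1,\dots,B_{n_s})$, $\mu=\min_i\rho_i\cdot\sigma_{\min}(\mathbb E[x_0x_0^T])$; $\|\cdot\|$ is the spectral norm of a matrix and $\sigma_{\min}$ the smallest singular value. **Theorem.** Suppose $\hat K^0\in\mathcal K$ and $C(\hat K^0)<\infty$. On $\mathcal K$ the cost $C$ is finite and differentiable, the coupled Lyapunov equations have exactly one solution, the series defining $\chi_{\hat K}$ converge, and $\chi_{\hat K}\succ0$. The coupled Riccati equations $$P_i=Q_i+A_i^T\mathcal E_i(P)A_i-A_i^T\mathcal E_i(P)B_i\big(R_i+B_i^T\mathcal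 E_i(P)B_i\big)^{-1}B_i^T\mathcal E_i(P)A_i$$ have exactly one positive definite solution $P$, and the gain $K_i^*=(R_i+B_i^T\mathcal E_i(P)B_i)^{-1}B_i^T\mathcal E_i(P)A_i$ lies in $\mathcal K$ and is the unique global minimizer $\hat K^*$ of $C$ over $\mathcal K$. Moreover: * **Gauss–Newton.** For every step size $0<\eta\le\frac12$, the iteration $K_i^{n+1}=K_i^n-2\eta\,\Psi_i(\hat K^n)^{-1}L_i(\hat K^n)$ stays in $\mathcal K$, converges to $\hat K^*$, and for all $n\ge0$ $$C(\hat K^n)-C(\hat K^*)\le\Big(1-\frac{2\eta\mu}{\|\chi_{\hat K^*}\|}\Big)^n\big(C(\hat K^0)-C(\hat K^*)\big).$$ * **Natural policy gradient.** For every step size $0<\eta\le\frac{1}{2\left(\|\hat R\|+\|\hat B\|^2C(\hat K^0)/\mu\right)}$, the iteration $\hat K^{n+1}=\hat K^n-\eta\,\nabla C(\hat K^n)\,\chi_{\hat K^n}^{-1}$ stays in $\mathcal K$, converges to $\hat K^*$, and for all $n\ge0$ $$C(\hat K^n)-C(\hat K^*)\le\Big(1-\frac{2\eta\mu\,\sigma_{\min}(\hat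 R)}{\|\chi_{\hat K^*}\|}\Big)^n\big(C(\hat K^0)-C(\hat K^*)\big).$$ In both cases the rate (the number in the large parentheses) lies in $[0,1)$. -/

import Mathlib

open Filter Topology MeasureTheory ProbabilityTheory
open scoped Matrix ENNReal

universe u

noncomputable section

namespace MJLS

/-! ### Matrix quantities -/

section Norms

open scoped Matrix.Norms.L2Operator

/-- The spectral norm `‖M‖` (operator norm for the Euclidean norms). -/
def specNorm {m n : Type*} [Fintype m] [Fintype n] [DecidableEq n]
    (M : Matrix m n ℝ) : ℝ := ‖M‖

end Norms

/-- The minimum singular value of a square matrix. Mathlib lists the singular values in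
decreasing order with indices starting at `0`, so the smallest one has index `card n - 1`. -/
def sigmaMin {n : Type*} [Fintype n] [DecidableEq n] (Z : Matrix n n ℝ) : ℝ :=
  (Matrix.toEuclideanLin Z).singularValues (Fintype.card n - 1)

/-! ### Data of the problem -/

/-- The data of a quadratic control problem for a Markovian jump linear system with modes
`Fin N`, states in `ℝᵈ` and inputs in `ℝᵏ`: system matrices, cost matrices, and transition
probabilities `p i j` from mode `i` to mode `j`. -/
structure JumpSystem (N d k : ℕ) where
  A : Fin N → Matrix (Fin d) (Fin d) ℝ
  B : Fin N → Matrix (Fin d) (Fin k) ℝ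
  Q : Fin N → Matrix (Fin d) (Fin d) ℝ
  R : Fin N → Matrix (Fin k) (Fin k) ℝ
  p : Fin N → Fin N → ℝ

/-- Mode-dependent feedback gains `K = [K₁ ⋯ K_N]`. -/
abbrev Gains (N d k : ℕ) : Type := Fin N → Matrix (Fin k) (Fin d) ℝ

/-- `ω` is a Markov chain on `Fin N` with initial distribution `ρ` and transition
probabilities `p`, on the probability space `(Ω, P)`. -/
structure IsMarkovChain {Ω : Type*} [MeasurableSpace Ω] (P : Measure Ω) {N : ℕ}
    (ω : ℕ → Ω → Fin N) (ρ : Fin N → ℝ) (p : Fin N → Fin N → ℝ) : Prop where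
  measurable : ∀ t, Measurable (ω t)
  init : ∀ i, P.real {w | ω 0 w = i} = ρ i
  step : ∀ (t : ℕ) (i : ℕ → Fin N) (j : Fin N),
    P.real {w | (∀ s ≤ t, ω s w = i s) ∧ ω (t + 1) w = j} =
      P.real {w | ∀ s ≤ t, ω s w = i s} * p (i t) j

/-- The random initial state `x₀` has finite second moment and is independent of the
mode process. -/
structure IsInitialState {Ω : Type*} [MeasurableSpace Ω] (P : Measure Ω) {N d : ℕ}
    (ω : ℕ → Ω → Fin N) (x₀ : Ω → Fin d → ℝ) : Prop where
  measurable : Measurable x₀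
  memLp : MemLp x₀ 2 P
  indep : IndepFun x₀ (fun w t => ω t w) P

/-- The second moment matrix `E[x₀ x₀ᵀ]`. -/
def secondMoment {Ω : Type*} [MeasurableSpace Ω] (P : Measure Ω) {d : ℕ}
    (x₀ : Ω → Fin d → ℝ) : Matrix (Fin d) (Fin d) ℝ :=
  Matrix.of fun a b => ∫ w, x₀ w a * x₀ w b ∂P

/-- `μ = minᵢ ρᵢ · σ_min (E[x₀ x₀ᵀ])`. -/
def mu {Ω : Type*} [MeasurableSpace Ω] (P : Measure Ω) {N d : ℕ}
    (ρ : Fin N → ℝ) (x₀ : Ω → Fin d → ℝ) : ℝ :=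
  (⨅ i, ρ i) * sigmaMin (secondMoment P x₀)

/-! Gains as Euclidean vectors; the Euclidean inner product of two such vectors is the
Frobenius inner product of the gains. -/

/-- The Euclidean vector of all entries of a gain. -/
def toVec {N d k : ℕ} (K : Gains N d k) : EuclideanSpace ℝ (Fin N × Fin k × Fin d) :=
  WithLp.toLp 2 fun e => K e.1 e.2.1 e.2.2

/-- The gain with the given entries; the inverse of `toVec`. -/
def ofVec {N d k : ℕ} (v : EuclideanSpace ℝ (Fin N × Fin k × Fin d)) : Gains N d k :=
  fun i => Matrix.of fun a b => v (i, a, b)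

namespace JumpSystem

variable {N d k : ℕ}

/-- `ℰᵢ(P) = ∑ⱼ pᵢⱼ Pⱼ`. -/
def nextMean (S : JumpSystem N d k) (Y : Fin N → Matrix (Fin d) (Fin d) ℝ) (i : Fin N) :
    Matrix (Fin d) (Fin d) ℝ :=
  ∑ j, S.p i j • Y j

/-! ### Closed loop, cost and mean-square stability -/

/-- The closed-loop state `x_{t+1} = A_{ω(t)} x_t + B_{ω(t)} u_t` with `u_t = -K_{ω(t)} x_t`. -/
def state {Ω : Type*} (S : JumpSystem N d k) (ω : ℕ → Ω → Fin N) (x₀ : Ω → Fin d → ℝ)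
    (K : Gains N d k) : ℕ → Ω → Fin d → ℝ
  | 0, w => x₀ w
  | t + 1, w =>
      S.A (ω t w) *ᵥ S.state ω x₀ K t w
        + S.B (ω t w) *ᵥ (-(K (ω t w) *ᵥ S.state ω x₀ K t w))

/-- The input `u_t = -K_{ω(t)} x_t`. -/
def input {Ω : Type*} (S : JumpSystem N d k) (ω : ℕ → Ω → Fin N) (x₀ : Ω → Fin d → ℝ)
    (K : Gains N d k) (t : ℕ) (w : Ω) : Fin k → ℝ :=
  -(K (ω t w) *ᵥ S.state ω x₀ K t w)

/-- The stage cost `x_tᵀ Q_{ω(t)} x_t + u_tᵀ R_{ω(t)} u_t`. -/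
def stageCost {Ω : Type*} (S : JumpSystem N d k) (ω : ℕ → Ω → Fin N) (x₀ : Ω → Fin d → ℝ)
    (K : Gains N d k) (t : ℕ) (w : Ω) : ℝ :=
  S.state ω x₀ K t w ⬝ᵥ (S.Q (ω t w) *ᵥ S.state ω x₀ K t w)
    + S.input ω x₀ K t w ⬝ᵥ (S.R (ω t w) *ᵥ S.input ω x₀ K t w)

/-- The cost `E[∑ₜ x_tᵀ Q_{ω(t)} x_t + u_tᵀ R_{ω(t)} u_t]`, possibly infinite. The stage costs
are nonnegative as soon as all `Qᵢ`, `Rᵢ` are positive semidefinite. -/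
def cost {Ω : Type*} [MeasurableSpace Ω] (S : JumpSystem N d k) (P : Measure Ω)
    (ω : ℕ → Ω → Fin N) (x₀ : Ω → Fin d → ℝ) (K : Gains N d k) : ℝ≥0∞ :=
  ∫⁻ w, ∑' t, ENNReal.ofReal (S.stageCost ω x₀ K t w) ∂P

/-- The cost as a real number; meaningful where the cost is finite. -/
def costReal {Ω : Type*} [MeasurableSpace Ω] (S : JumpSystem N d k) (P : Measure Ω)
    (ω : ℕ → Ω → Fin N) (x₀ : Ω → Fin d → ℝ) (K : Gains N d k) : ℝ :=
  (S.cost P ω x₀ K).toReal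

/-- `K` stabilizes the system in the mean square sense: `E‖x_t‖² → 0` for every initial state
with finite second moment and every initial distribution of the modes. -/
def MeanSquareStabilizing (S : JumpSystem N d k) (K : Gains N d k) : Prop :=
  ∀ (Ω : Type u) [MeasurableSpace Ω] (P : Measure Ω) [IsProbabilityMeasure P]
    (ω : ℕ → Ω → Fin N) (ρ : Fin N → ℝ) (x₀ : Ω → Fin d → ℝ),
    IsMarkovChain P ω ρ S.p → IsInitialState P ω x₀ →
      Tendsto (fun t => ∫ w, S.state ω x₀ K t w ⬝ᵥ S.state ω x₀ K t w ∂P) atTop (𝓝 0)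

/-! ### State correlation -/

/-- `Xᵢ(t) = E[x_t x_tᵀ 1{ω(t) = i}]`. -/
def modeMoment {Ω : Type*} [MeasurableSpace Ω] (S : JumpSystem N d k) (P : Measure Ω)
    (ω : ℕ → Ω → Fin N) (x₀ : Ω → Fin d → ℝ) (K : Gains N d k) (i : Fin N) (t : ℕ) :
    Matrix (Fin d) (Fin d) ℝ :=
  Matrix.of fun a b =>
    ∫ w, {w | ω t w = i}.indicator
      (fun w => S.state ω x₀ K t w a * S.state ω x₀ K t w b) w ∂P

/-- The `i`-th diagonal block `∑ₜ Xᵢ(t)` of `χ_K`. -/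
def chiBlock {Ω : Type*} [MeasurableSpace Ω] (S : JumpSystem N d k) (P : Measure Ω)
    (ω : ℕ → Ω → Fin N) (x₀ : Ω → Fin d → ℝ) (K : Gains N d k) (i : Fin N) :
    Matrix (Fin d) (Fin d) ℝ :=
  ∑' t, S.modeMoment P ω x₀ K i t

/-- `χ_K = diag(∑ₜ X₁(t), …, ∑ₜ X_N(t))`. -/
def chi {Ω : Type*} [MeasurableSpace Ω] (S : JumpSystem N d k) (P : Measure Ω)
    (ω : ℕ → Ω → Fin N) (x₀ : Ω → Fin d → ℝ) (K : Gains N d k) :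
    Matrix (Fin d × Fin N) (Fin d × Fin N) ℝ :=
  Matrix.blockDiagonal (S.chiBlock P ω x₀ K)

/-! ### Lyapunov and Riccati equations -/

/-- The coupled Lyapunov equations
`Yᵢ = Qᵢ + Kᵢᵀ Rᵢ Kᵢ + (Aᵢ - Bᵢ Kᵢ)ᵀ ℰᵢ(Y) (Aᵢ - Bᵢ Kᵢ)`. -/
def IsLyapunovSolution (S : JumpSystem N d k) (K : Gains N d k)
    (Y : Fin N → Matrix (Fin d) (Fin d) ℝ) : Prop :=
  ∀ i, Y i = S.Q i + (K i)ᵀ * S.R i * K i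
    + (S.A i - S.B i * K i)ᵀ * S.nextMean Y i * (S.A i - S.B i * K i)

open Classical in
/-- `P^K`, the solution of the coupled Lyapunov equations (and `0` if there is none). -/
def lyapunov (S : JumpSystem N d k) (K : Gains N d k) : Fin N → Matrix (Fin d) (Fin d) ℝ :=
  if h : ∃ Y, S.IsLyapunovSolution K Y then h.choose else 0

/-- The coupled algebraic Riccati equations. -/
def IsRiccatiSolution (S : JumpSystem N d k)
    (Y : Fin N → Matrix (Fin d) (Fin d) ℝ) : Prop :=
  ∀ i, Y i = S.Q i + (S.A i)ᵀ * S.nextMean Y i * S.A i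
    - (S.A i)ᵀ * S.nextMean Y i * S.B i
      * (S.R i + (S.B i)ᵀ * S.nextMean Y i * S.B i)⁻¹
      * ((S.B i)ᵀ * S.nextMean Y i * S.A i)

/-- The gain `Kᵢ = (Rᵢ + Bᵢᵀ ℰᵢ(Y) Bᵢ)⁻¹ Bᵢᵀ ℰᵢ(Y) Aᵢ`. -/
def riccatiGain (S : JumpSystem N d k) (Y : Fin N → Matrix (Fin d) (Fin d) ℝ) :
    Gains N d k :=
  fun i => (S.R i + (S.B i)ᵀ * S.nextMean Y i * S.B i)⁻¹
    * ((S.B i)ᵀ * S.nextMean Y i * S.A i)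

/-! ### The two policy iterations -/

/-- `Rᵢ + Bᵢᵀ ℰᵢ(P^K) Bᵢ`. -/
def inputWeight (S : JumpSystem N d k) (K : Gains N d k) (i : Fin N) :
    Matrix (Fin k) (Fin k) ℝ :=
  S.R i + (S.B i)ᵀ * S.nextMean (S.lyapunov K) i * S.B i

/-- `Lᵢ(K) = (Rᵢ + Bᵢᵀ ℰᵢ(P^K) Bᵢ) Kᵢ - Bᵢᵀ ℰᵢ(P^K) Aᵢ`. -/
def gradFactor (S : JumpSystem N d k) (K : Gains N d k) (i : Fin N) :
    Matrix (Fin k) (Fin d) ℝ :=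
  S.inputWeight K i * K i - (S.B i)ᵀ * S.nextMean (S.lyapunov K) i * S.A i

/-- One Gauss–Newton step: `Kᵢ ↦ Kᵢ - 2η (Rᵢ + Bᵢᵀ ℰᵢ(P^K) Bᵢ)⁻¹ Lᵢ(K)`. -/
def gaussNewtonStep (S : JumpSystem N d k) (η : ℝ) (K : Gains N d k) : Gains N d k :=
  fun i => K i - (2 * η) • ((S.inputWeight K i)⁻¹ * S.gradFactor K i)

/-- The cost as a function of the vector of all entries of the gain. -/
def costOfVec {Ω : Type*} [MeasurableSpace Ω] (S : JumpSystem N d k) (P : Measure Ω)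
    (ω : ℕ → Ω → Fin N) (x₀ : Ω → Fin d → ℝ)
    (v : EuclideanSpace ℝ (Fin N × Fin k × Fin d)) : ℝ :=
  S.costReal P ω x₀ (ofVec v)

/-- The gradient `∇C(K)` with respect to the Frobenius inner product, as a block row. -/
def costGradient {Ω : Type*} [MeasurableSpace Ω] (S : JumpSystem N d k) (P : Measure Ω)
    (ω : ℕ → Ω → Fin N) (x₀ : Ω → Fin d → ℝ) (K : Gains N d k) : Gains N d k :=
  ofVec (gradient (S.costOfVec P ω x₀) (toVec K))

/-- One natural policy gradient step `K ↦ K - η ∇C(K) χ_K⁻¹`, written block by block: `χ_K` is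
block diagonal, so that its inverse multiplies the `i`-th block of the block row `∇C(K)` by the
inverse of its `i`-th diagonal block. -/
def naturalGradientStep {Ω : Type*} [MeasurableSpace Ω] (S : JumpSystem N d k) (P : Measure Ω)
    (ω : ℕ → Ω → Fin N) (x₀ : Ω → Fin d → ℝ) (η : ℝ) (K : Gains N d k) : Gains N d k :=
  fun i => K i - η • (S.costGradient P ω x₀ K i * (S.chiBlock P ω x₀ K i)⁻¹)

end JumpSystem

end MJLS

end

/-!
The proof works with the linear operator `dualStep K : Y ↦ (Fᵢᵀ ℰᵢ(Y) Fᵢ)ᵢ`, `Fᵢ = Aᵢ - Bᵢ Kᵢ`, on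
families of matrices, and the trace pairing `⟨Y, X⟩ = ∑ᵢ tr (Yᵢ Xᵢ)`. The Markov property and the
independence of `x₀` from the modes give `⟨Y, X(t+1)⟩ = ⟨dualStep K Y, X(t)⟩` for the mode moments
`X(t)` (`pairing_modeMoment_succ`). This is the only probabilistic input; everything else is linear
algebra in finite dimensions.

*Stability.* `K` is called stable if `(dualStep K)ᵗ Z → 0` for all `Z`. Since `X(0) ≥ μ > 0`,
convergence of `E‖x_t‖²` for the single given process already forces this, and it conversely gives
mean square stability for every process (`meanSquareStabilizing_iff`). A strict Lyapunov inequality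
certifies stability (`isStable_of_lyapunov_inequality`). For stable `K` the map `1 - dualStep K` is
injective, hence bijective, so the Lyapunov equations have exactly one solution `P^K`, and
telescoping gives `C(K) = ⟨P^K, X(0)⟩` and `⟨Y - dualStep K Y, χ_K⟩ = ⟨Y, X(0)⟩`.

*Cost difference.* Writing `Δ = K' - K`, the latter identity with `Y = P^K` yields the exact formula
`C(K') - C(K) = ⟨Δᵀ L + Lᵀ Δ + Δᵀ Ψ Δ, χ_{K'}⟩` (`costReal_sub_costReal`). It has four consequences.
With the continuity of `χ` it gives differentiability and `∇C(K) = 2 L χ_K`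
(`hasGradientAt_costOfVec`). Completing the square gives gradient domination
`C(K) - C(K') ≤ ‖χ_{K'}‖ ∑ᵢ tr (Lᵢᵀ Ψᵢ⁻¹ Lᵢ)`. If `L` vanishes at `K`, it gives quadratic growth of
`C` around `K`. If `Δᵀ L + Lᵀ Δ + Δᵀ Ψ Δ ≤ -c Lᵀ Ψ⁻¹ L` with `c ≥ 0`, then `P^K` is a Lyapunov
certificate for `K'`, and the cost drops by at least `c μ ∑ᵢ tr (Lᵢᵀ Ψᵢ⁻¹ Lᵢ)`.

*Convergence.* Domination and decrease together contract the optimality gap by `1 - c μ / ‖χ_{K*}‖`,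
and quadratic growth turns this into convergence of the gains (`iterate_convergence`). A
Gauss–Newton step satisfies the decrease condition with `c = 2η`. A natural gradient step is
`Δ = -2η L` and satisfies it with `c = 2η σ_min(R̂)`, because
`σ_min(R̂) ≤ Ψᵢ ≤ ‖R̂‖ + ‖B̂‖² C(K⁰) / μ` on the sublevel set of `K⁰`.

*Optimal gain.* The pairs `(K, P^K)` of bounded cost form a compact set, so the cost has a
minimizer; a Gauss–Newton step cannot improve it, hence `L = 0` there (`exists_critical`). A gain is critical
exactly if it is the Riccati gain of its value matrices, and positive definite Riccati solutions are
exactly the value matrices of critical gains (`isRiccatiSolution_iff`, `factorOf_eq_zero_iff`).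
Quadratic growth makes critical gains unique.
-/

namespace MJLS

/-! ### Positive semidefinite real matrices -/

section LinearAlgebra

variable {n m : Type*}

theorem _root_.Matrix.PosSemidef.transpose_eq {M : Matrix n n ℝ} (hM : M.PosSemidef) :
    Mᵀ = M := by
  have := hM.isHermitian
  rwa [Matrix.IsHermitian, Matrix.conjTranspose_eq_transpose_of_trivial] at this

theorem _root_.Matrix.PosSemidef.smul_nonneg {M : Matrix n n ℝ} (hM : M.PosSemidef) {c : ℝ}
    (hc : 0 ≤ c) : (c • M).PosSemidef := hM.smul hc

variable [Fintype n] [Fintype m]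

theorem posSemidef_of_transpose_eq {M : Matrix n n ℝ} (hM : Mᵀ = M)
    (h : ∀ v : n → ℝ, 0 ≤ v ⬝ᵥ (M *ᵥ v)) : M.PosSemidef :=
  Matrix.PosSemidef.of_dotProduct_mulVec_nonneg
    (by rw [Matrix.IsHermitian, Matrix.conjTranspose_eq_transpose_of_trivial, hM])
    (fun v => by simpa using h v)

theorem _root_.Matrix.PosSemidef.quadratic_nonneg {M : Matrix n n ℝ} (hM : M.PosSemidef)
    (v : n → ℝ) : 0 ≤ v ⬝ᵥ (M *ᵥ v) := by
  simpa using hM.dotProduct_mulVec_nonneg v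

theorem _root_.Matrix.PosSemidef.transpose_mul_mul_same {M : Matrix n n ℝ} (hM : M.PosSemidef)
    (B : Matrix n m ℝ) : (Bᵀ * M * B).PosSemidef := by
  simpa [Matrix.conjTranspose_eq_transpose_of_trivial] using hM.conjTranspose_mul_mul_same B

theorem posSemidef_transpose_mul_self (B : Matrix n m ℝ) : (Bᵀ * B).PosSemidef := by
  simpa [Matrix.conjTranspose_eq_transpose_of_trivial] using
    Matrix.posSemidef_conjTranspose_mul_self B

theorem trace_mul_nonneg {A X : Matrix n n ℝ} (hA : A.PosSemidef) (hX : X.PosSemidef) :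
    0 ≤ (A * X).trace := by
  classical
  obtain ⟨C, rfl⟩ : ∃ C : Matrix n n ℝ, X = Cᵀ * C := by
    open scoped MatrixOrder in
    have := (CStarAlgebra.nonneg_iff_eq_star_mul_self (a := X)).1 hX.nonneg
    simpa [Matrix.star_eq_conjTranspose, Matrix.conjTranspose_eq_transpose_of_trivial] using this
  rw [← Matrix.mul_assoc, Matrix.trace_mul_comm, ← Matrix.mul_assoc]
  simpa using (hA.transpose_mul_mul_same Cᵀ).trace_nonneg

theorem trace_mul_le_trace_mul {A B X : Matrix n n ℝ} (hAB : (B - A).PosSemidef)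
    (hX : X.PosSemidef) : (A * X).trace ≤ (B * X).trace := by
  have := trace_mul_nonneg hAB hX
  rw [Matrix.sub_mul, Matrix.trace_sub] at this
  linarith

theorem trace_mul_le_trace_mul_right {A B X : Matrix n n ℝ} (hAB : (B - A).PosSemidef)
    (hX : X.PosSemidef) : (X * A).trace ≤ (X * B).trace := by
  rw [Matrix.trace_mul_comm X A, Matrix.trace_mul_comm X B]
  exact trace_mul_le_trace_mul hAB hX

theorem abs_entry_le_trace {X : Matrix n n ℝ} (hX : X.PosSemidef) (a b : n) :
    |X a b| ≤ X.trace := by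
  classical
  have hd : ∀ c, 0 ≤ X c c := fun c => hX.diag_nonneg
  have hs : X b a = X a b := by
    have := congrFun (congrFun hX.transpose_eq a) b
    simpa using this
  have h1 := hX.quadratic_nonneg (Pi.single a 1 + Pi.single b 1)
  have h2 := hX.quadratic_nonneg (Pi.single a 1 - Pi.single b 1)
  simp [Matrix.mulVec_add, Matrix.mulVec_sub, hs] at h1 h2
  have htr : (X a a + X b b) / 2 ≤ X.trace := by
    have ha : X a a ≤ X.trace :=
      Finset.single_le_sum (f := fun c => X c c) (fun c _ => hd c) (Finset.mem_univ a)
    have hb : X b b ≤ X.trace :=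
      Finset.single_le_sum (f := fun c => X c c) (fun c _ => hd c) (Finset.mem_univ b)
    linarith
  rw [abs_le]
  constructor <;> linarith

/-- The sum of the absolute values of the entries of a matrix. -/
noncomputable def absSum (M : Matrix n m ℝ) : ℝ := ∑ a, ∑ b, |M a b|

theorem absSum_nonneg (M : Matrix n m ℝ) : 0 ≤ absSum M :=
  Finset.sum_nonneg fun _ _ => Finset.sum_nonneg fun _ _ => abs_nonneg _

theorem abs_bilin_le (M : Matrix n n ℝ) (u v : n → ℝ) :
    |u ⬝ᵥ (M *ᵥ v)| ≤ absSum M * (u ⬝ᵥ u + v ⬝ᵥ v) := by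
  have key : ∀ a b, |u a * (M a b * v b)| ≤ |M a b| * (u ⬝ᵥ u + v ⬝ᵥ v) := by
    intro a b
    have hu : u a * u a ≤ u ⬝ᵥ u :=
      Finset.single_le_sum (f := fun c => u c * u c) (fun c _ => mul_self_nonneg _)
        (Finset.mem_univ a)
    have hv : v b * v b ≤ v ⬝ᵥ v :=
      Finset.single_le_sum (f := fun c => v c * v c) (fun c _ => mul_self_nonneg _)
        (Finset.mem_univ b)
    have huv : |u a * v b| ≤ u ⬝ᵥ u + v ⬝ᵥ v := by
      rw [abs_le]
      constructor <;> nlinarith [sq_nonneg (u a + v b), sq_nonneg (u a - v b)]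
    calc |u a * (M a b * v b)| = |M a b| * |u a * v b| := by
          rw [← abs_mul]; congr 1; ring
      _ ≤ _ := mul_le_mul_of_nonneg_left huv (abs_nonneg _)
  simp only [dotProduct, Matrix.mulVec, absSum, Finset.mul_sum] at *
  refine (Finset.abs_sum_le_sum_abs _ _).trans ?_
  simp only [Finset.sum_mul]
  refine Finset.sum_le_sum fun a _ => ?_
  refine (Finset.abs_sum_le_sum_abs _ _).trans ?_
  exact Finset.sum_le_sum fun b _ => key a b

theorem posSemidef_smul_one_sub_of_absSum_le [DecidableEq n] {M : Matrix n n ℝ} (hM : Mᵀ = M)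
    {c : ℝ} (hc : 2 * absSum M ≤ c) : (c • (1 : Matrix n n ℝ) - M).PosSemidef := by
  refine posSemidef_of_transpose_eq (by simp [hM]) fun v => ?_
  have h := abs_bilin_le M v v
  have hv : 0 ≤ v ⬝ᵥ v := Finset.sum_nonneg fun c _ => mul_self_nonneg (v c)
  have h' := (abs_le.1 h).2
  simp only [Matrix.sub_mulVec, Matrix.smul_mulVec, Matrix.one_mulVec, dotProduct_sub,
    dotProduct_smul, smul_eq_mul]
  nlinarith

theorem abs_trace_mul_le (V X : Matrix n n ℝ) {t : ℝ} (hX : ∀ a b, |X a b| ≤ t) :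
    |(V * X).trace| ≤ absSum V * t := by
  simp only [Matrix.trace, Matrix.diag, Matrix.mul_apply, absSum, Finset.sum_mul]
  refine (Finset.abs_sum_le_sum_abs _ _).trans (Finset.sum_le_sum fun a _ => ?_)
  refine (Finset.abs_sum_le_sum_abs _ _).trans (Finset.sum_le_sum fun b _ => ?_)
  rw [abs_mul]
  exact mul_le_mul_of_nonneg_left (hX b a) (abs_nonneg _)

/-! ### Smallest singular value and spectral norm -/

theorem sigmaMin_nonneg [DecidableEq n] (Z : Matrix n n ℝ) : 0 ≤ sigmaMin Z :=
  LinearMap.singularValues_nonneg _ _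

theorem sigmaMin_pos [DecidableEq n] [Nonempty n] {Z : Matrix n n ℝ} (hZ : Z.PosDef) :
    0 < sigmaMin Z := by
  have hinj : Function.Injective (Matrix.toEuclideanLin Z) := by
    rw [← LinearMap.ker_eq_bot, LinearMap.ker_eq_bot']
    intro v hv
    have h0 : Z *ᵥ v.ofLp = 0 := by
      have := congrArg WithLp.ofLp hv
      simpa [Matrix.toLpLin_apply] using this
    by_contra hne
    have := hZ.dotProduct_mulVec_pos (x := v.ofLp) (by simpa using hne)
    simp [h0] at this
  refine (LinearMap.injective_iff_forall_lt_finrank_singularValues_pos _).1 hinj _ ?_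
  rw [finrank_euclideanSpace]
  have := Fintype.card_pos (α := n)
  omega

/-- A positive definite matrix is bounded below by its smallest singular value, because its
singular values are its eigenvalues. -/
theorem posSemidef_sub_sigmaMin [DecidableEq n] {Z : Matrix n n ℝ} (hZ : Z.PosDef) :
    (Z - sigmaMin Z • (1 : Matrix n n ℝ)).PosSemidef := by
  have hH : (Z - sigmaMin Z • (1 : Matrix n n ℝ)).IsHermitian := by
    refine hZ.1.sub ?_
    simp [Matrix.IsHermitian, Matrix.conjTranspose_eq_transpose_of_trivial]
  rw [hH.posSemidef_iff_eigenvalues_nonneg]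
  intro i
  set c := hH.eigenvalues i with hc
  set v : EuclideanSpace ℝ n := hH.eigenvectorBasis i with hv
  have hv0 : v ≠ 0 := (hH.eigenvectorBasis.orthonormal.ne_zero i)
  have hZv : Z *ᵥ v.ofLp = (c + sigmaMin Z) • v.ofLp := by
    have := hH.mulVec_eigenvectorBasis i
    rw [Matrix.sub_mulVec, Matrix.smul_mulVec, Matrix.one_mulVec] at this
    rw [add_smul, ← sub_eq_iff_eq_add]
    exact this
  have hv0' : v.ofLp ≠ 0 := by simpa using hv0
  have hpos : 0 < c + sigmaMin Z := by
    have h1 := hZ.dotProduct_mulVec_pos hv0'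
    rw [hZv] at h1
    simp only [star_trivial, dotProduct_smul, smul_eq_mul] at h1
    have h2 : 0 ≤ v.ofLp ⬝ᵥ v.ofLp := Finset.sum_nonneg fun c _ => mul_self_nonneg _
    by_contra hcon
    push Not at hcon
    nlinarith
  set T := Matrix.toEuclideanLin Z with hT
  have hTv : T v = (c + sigmaMin Z) • v := by
    apply (WithLp.ofLp_injective 2)
    simpa [hT, Matrix.toLpLin_apply] using hZv
  have hadj : LinearMap.adjoint T = T := by
    rw [hT, ← Matrix.toEuclideanLin_conjTranspose_eq_adjoint, hZ.1.eq]
  have hev : Module.End.HasEigenvalue (LinearMap.adjoint T ∘ₗ T) ((c + sigmaMin Z) ^ 2) := by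
    refine Module.End.hasEigenvalue_of_hasEigenvector (x := v) ⟨?_, hv0⟩
    rw [Module.End.mem_eigenspace_iff, hadj, LinearMap.comp_apply, hTv, map_smul, hTv, smul_smul,
      sq]
  obtain ⟨j, hj⟩ := T.isSymmetric_adjoint_comp_self.exists_eigenvalues_eq
    (finrank_euclideanSpace (𝕜 := ℝ) (ι := n)) hev
  have hj' : T.singularValues j ^ 2 = (c + sigmaMin Z) ^ 2 := by
    rw [T.sq_singularValues_fin (finrank_euclideanSpace (𝕜 := ℝ) (ι := n))]
    simpa using hj
  have hle : sigmaMin Z ≤ T.singularValues j :=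
    T.singularValues_antitone (by have := j.2; omega)
  have heq : T.singularValues j = c + sigmaMin Z :=
    (sq_eq_sq₀ (T.singularValues_nonneg _) hpos.le).1 hj'
  change 0 ≤ c
  linarith

theorem dotProduct_self_eq_norm_sq (v : n → ℝ) : v ⬝ᵥ v = ‖WithLp.toLp 2 v‖ ^ 2 := by
  rw [EuclideanSpace.norm_sq_eq]
  simp [dotProduct, sq]

theorem specNorm_nonneg [DecidableEq n] (M : Matrix m n ℝ) : 0 ≤ specNorm M := by
  open scoped Matrix.Norms.L2Operator in
  exact norm_nonneg M

theorem mulVec_dotProduct_mulVec_le [DecidableEq n] (M : Matrix m n ℝ) (v : n → ℝ) :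
    (M *ᵥ v) ⬝ᵥ (M *ᵥ v) ≤ specNorm M ^ 2 * (v ⬝ᵥ v) := by
  rw [dotProduct_self_eq_norm_sq, dotProduct_self_eq_norm_sq, ← mul_pow]
  refine pow_le_pow_left₀ (norm_nonneg _) ?_ 2
  open scoped Matrix.Norms.L2Operator in
  exact Matrix.l2_opNorm_mulVec M (WithLp.toLp 2 v)

theorem posSemidef_specNorm_sq_sub [DecidableEq n] (M : Matrix m n ℝ) :
    (specNorm M ^ 2 • (1 : Matrix n n ℝ) - Mᵀ * M).PosSemidef := by
  refine posSemidef_of_transpose_eq (by simp) fun v => ?_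
  have h := mulVec_dotProduct_mulVec_le M v
  have h2 : v ⬝ᵥ ((Mᵀ * M) *ᵥ v) = (M *ᵥ v) ⬝ᵥ (M *ᵥ v) := by
    rw [← Matrix.mulVec_mulVec, Matrix.dotProduct_mulVec, Matrix.vecMul_transpose]
  rw [Matrix.sub_mulVec, dotProduct_sub, h2, Matrix.smul_mulVec, Matrix.one_mulVec,
    dotProduct_smul, smul_eq_mul]
  linarith

theorem posSemidef_specNorm_sub [DecidableEq n] {M : Matrix n n ℝ} (hM : Mᵀ = M) :
    (specNorm M • (1 : Matrix n n ℝ) - M).PosSemidef := by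
  refine posSemidef_of_transpose_eq (by simp [hM]) fun v => ?_
  have h := mulVec_dotProduct_mulVec_le M v
  rw [dotProduct_self_eq_norm_sq, dotProduct_self_eq_norm_sq, ← mul_pow] at h
  have h1 := (pow_le_pow_iff_left₀ (norm_nonneg _)
    (mul_nonneg (specNorm_nonneg M) (norm_nonneg _)) two_ne_zero).1 h
  have h3 : v ⬝ᵥ (M *ᵥ v) ≤ ‖WithLp.toLp 2 v‖ * ‖WithLp.toLp 2 (M *ᵥ v)‖ := by
    have := real_inner_le_norm (WithLp.toLp 2 v) (WithLp.toLp 2 (M *ᵥ v))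
    rw [EuclideanSpace.inner_eq_star_dotProduct] at this
    simpa [dotProduct_comm] using this
  rw [Matrix.sub_mulVec, dotProduct_sub, Matrix.smul_mulVec, Matrix.one_mulVec,
    dotProduct_smul, smul_eq_mul, dotProduct_self_eq_norm_sq]
  nlinarith [norm_nonneg (WithLp.toLp 2 v)]

end LinearAlgebra

section Blocks

variable {n m o : Type*} [DecidableEq o]

theorem blockDiagonal_submatrix (M : o → Matrix m n ℝ) (i : o) :
    (Matrix.blockDiagonal M).submatrix (fun a => (a, i)) (fun a => (a, i)) = M i := by
  ext a b
  simp

theorem one_submatrix_block [DecidableEq n] (i : o) :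
    (1 : Matrix (n × o) (n × o) ℝ).submatrix (fun a => (a, i)) (fun a => (a, i)) = 1 := by
  rw [← Matrix.blockDiagonal_one]
  exact blockDiagonal_submatrix (m := n) (n := n) (o := o) 1 i

variable [Fintype n] [Fintype m] [Fintype o]

theorem posDef_blockDiagonal {M : o → Matrix n n ℝ} (hM : ∀ i, (M i).PosDef) :
    (Matrix.blockDiagonal M).PosDef := by
  refine Matrix.PosDef.of_dotProduct_mulVec_pos ?_ fun {x} hx => ?_
  · rw [Matrix.IsHermitian, Matrix.blockDiagonal_conjTranspose]
    congr 1
    funext i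
    exact (hM i).1
  · have hsum : star x ⬝ᵥ (Matrix.blockDiagonal M *ᵥ x)
        = ∑ i, star (fun a => x (a, i)) ⬝ᵥ (M i *ᵥ fun a => x (a, i)) := by
      simp only [dotProduct, Fintype.sum_prod_type, Matrix.mulVec, Matrix.blockDiagonal_apply]
      rw [Finset.sum_comm]
      simp
    obtain ⟨⟨a, i⟩, hai⟩ : ∃ p, x p ≠ 0 := by
      by_contra hcon
      push Not at hcon
      exact hx (funext hcon)
    rw [hsum]
    refine Finset.sum_pos' (fun j _ => ?_) ⟨i, Finset.mem_univ i, ?_⟩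
    · exact (hM j).posSemidef.dotProduct_mulVec_nonneg _
    · exact (hM i).dotProduct_mulVec_pos fun h => hai (congrFun h a)

variable [DecidableEq n]

theorem posSemidef_block_sub_sigmaMin {M : o → Matrix n n ℝ} (hM : ∀ i, (M i).PosDef) (i : o) :
    (M i - sigmaMin (Matrix.blockDiagonal M) • (1 : Matrix n n ℝ)).PosSemidef := by
  have h := (posSemidef_sub_sigmaMin (posDef_blockDiagonal hM)).submatrix (fun a => (a, i))
  rwa [Matrix.submatrix_sub, Matrix.submatrix_smul, Pi.sub_apply, Pi.sub_apply, Pi.smul_apply,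
    Pi.smul_apply, one_submatrix_block, blockDiagonal_submatrix] at h

theorem posSemidef_specNorm_sub_block {M : o → Matrix n n ℝ} (hM : ∀ i, (M i)ᵀ = M i) (i : o) :
    (specNorm (Matrix.blockDiagonal M) • (1 : Matrix n n ℝ) - M i).PosSemidef := by
  have hT : (Matrix.blockDiagonal M)ᵀ = Matrix.blockDiagonal M := by
    rw [Matrix.blockDiagonal_transpose]; congr 1; funext i; exact hM i
  have h := (posSemidef_specNorm_sub hT).submatrix (fun a => (a, i))
  rwa [Matrix.submatrix_sub, Matrix.submatrix_smul, Pi.sub_apply, Pi.sub_apply, Pi.smul_apply,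
    Pi.smul_apply, one_submatrix_block, blockDiagonal_submatrix] at h

theorem posSemidef_specNorm_sq_sub_block (M : o → Matrix m n ℝ) (i : o) :
    (specNorm (Matrix.blockDiagonal M) ^ 2 • (1 : Matrix n n ℝ) - (M i)ᵀ * M i).PosSemidef := by
  have h := (posSemidef_specNorm_sq_sub (Matrix.blockDiagonal M)).submatrix (fun a => (a, i))
  rwa [Matrix.blockDiagonal_transpose, ← Matrix.blockDiagonal_mul, Matrix.submatrix_sub,
    Matrix.submatrix_smul, Pi.sub_apply, Pi.sub_apply, Pi.smul_apply,
    Pi.smul_apply, one_submatrix_block, blockDiagonal_submatrix] at h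

end Blocks

/-! ### Limits of matrices and the trace pairing -/

theorem tendsto_matrix {ι n m : Type*} {l : Filter ι} {f : ι → Matrix n m ℝ} {M : Matrix n m ℝ}
    (h : ∀ a b, Tendsto (fun x => f x a b) l (𝓝 (M a b))) : Tendsto f l (𝓝 M) :=
  tendsto_pi_nhds.2 fun a => tendsto_pi_nhds.2 fun b => h a b

theorem isClosed_posSemidef {n : Type*} [Fintype n] :
    IsClosed {M : Matrix n n ℝ | M.PosSemidef} := by
  have : {M : Matrix n n ℝ | M.PosSemidef}
      = {M | Mᵀ = M} ∩ ⋂ v : n → ℝ, {M | 0 ≤ v ⬝ᵥ (M *ᵥ v)} := by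
    ext M
    simp only [Set.mem_ofPred_eq, Set.mem_inter_iff, Set.mem_iInter]
    exact ⟨fun h => ⟨h.transpose_eq, h.quadratic_nonneg⟩,
      fun h => posSemidef_of_transpose_eq h.1 h.2⟩
  rw [this]
  refine (isClosed_eq (by fun_prop) continuous_id).inter (isClosed_iInter fun v => ?_)
  exact isClosed_le continuous_const (by fun_prop)

/-- The pairing `∑ᵢ tr (Yᵢ Xᵢ)` of two families of matrices. -/
noncomputable def pairing {N d : ℕ} (Y X : Fin N → Matrix (Fin d) (Fin d) ℝ) : ℝ :=
  ∑ i, (Y i * X i).trace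

section Pairing

variable {N d : ℕ} {A B X : Fin N → Matrix (Fin d) (Fin d) ℝ}

theorem pairing_add_left (A B X : Fin N → Matrix (Fin d) (Fin d) ℝ) :
    pairing (A + B) X = pairing A X + pairing B X := by
  simp [pairing, Matrix.add_mul, Finset.sum_add_distrib]

theorem pairing_sub_left (A B X : Fin N → Matrix (Fin d) (Fin d) ℝ) :
    pairing (A - B) X = pairing A X - pairing B X := by
  simp [pairing, Matrix.sub_mul, Finset.sum_sub_distrib]

theorem pairing_sum_right {N d : ℕ} {ι : Type*} (s : Finset ι)
    (A : Fin N → Matrix (Fin d) (Fin d) ℝ) (X : ι → Fin N → Matrix (Fin d) (Fin d) ℝ) :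
    pairing A (∑ t ∈ s, X t) = ∑ t ∈ s, pairing A (X t) := by
  simp only [pairing, Finset.sum_apply, Matrix.mul_sum, Matrix.trace_sum]
  exact Finset.sum_comm

theorem pairing_smul_left (c : ℝ) (A X : Fin N → Matrix (Fin d) (Fin d) ℝ) :
    pairing (c • A) X = c * pairing A X := by
  simp [pairing, Finset.mul_sum]

theorem pairing_smul_right (c : ℝ) (A X : Fin N → Matrix (Fin d) (Fin d) ℝ) :
    pairing A (c • X) = c * pairing A X := by
  simp [pairing, Finset.mul_sum]

theorem pairing_one_left (X : Fin N → Matrix (Fin d) (Fin d) ℝ) :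
    pairing 1 X = ∑ i, (X i).trace := by
  simp [pairing]

theorem pairing_one_right (A : Fin N → Matrix (Fin d) (Fin d) ℝ) :
    pairing A 1 = ∑ i, (A i).trace := by
  simp [pairing]

theorem pairing_nonneg (hA : ∀ i, (A i).PosSemidef) (hX : ∀ i, (X i).PosSemidef) :
    0 ≤ pairing A X :=
  Finset.sum_nonneg fun i _ => trace_mul_nonneg (hA i) (hX i)

theorem pairing_le_left (hAB : ∀ i, (B i - A i).PosSemidef) (hX : ∀ i, (X i).PosSemidef) :
    pairing A X ≤ pairing B X :=
  Finset.sum_le_sum fun i _ => trace_mul_le_trace_mul (hAB i) (hX i)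

theorem pairing_le_right (hAB : ∀ i, (B i - A i).PosSemidef) (hX : ∀ i, (X i).PosSemidef) :
    pairing X A ≤ pairing X B :=
  Finset.sum_le_sum fun i _ => trace_mul_le_trace_mul_right (hAB i) (hX i)

theorem trace_le_pairing_one (hX : ∀ i, (X i).PosSemidef) (i : Fin N) :
    (X i).trace ≤ pairing 1 X := by
  rw [pairing_one_left]
  exact Finset.single_le_sum (f := fun i => (X i).trace) (fun j _ => (hX j).trace_nonneg)
    (Finset.mem_univ i)

theorem continuous_pairing_left (X : Fin N → Matrix (Fin d) (Fin d) ℝ) :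
    Continuous fun A : Fin N → Matrix (Fin d) (Fin d) ℝ => pairing A X := by
  unfold pairing
  fun_prop

theorem continuous_pairing_right (A : Fin N → Matrix (Fin d) (Fin d) ℝ) :
    Continuous fun X : Fin N → Matrix (Fin d) (Fin d) ℝ => pairing A X := by
  unfold pairing
  fun_prop

end Pairing

namespace JumpSystem

variable {N d k : ℕ} (S : JumpSystem N d k)

/-! ### The closed-loop dynamics on value matrices -/

/-- The closed-loop matrices `Fᵢ = Aᵢ - Bᵢ Kᵢ`. -/
def closedLoop (K : Gains N d k) (i : Fin N) : Matrix (Fin d) (Fin d) ℝ := S.A i - S.B i * K i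

/-- The weight `Qᵢ + Kᵢᵀ Rᵢ Kᵢ` of the stage cost in closed loop. -/
def stageWeight (K : Gains N d k) (i : Fin N) : Matrix (Fin d) (Fin d) ℝ :=
  S.Q i + (K i)ᵀ * S.R i * K i

/-- The linear operator `Y ↦ (Fᵢᵀ ℰᵢ(Y) Fᵢ)ᵢ`, the adjoint of the evolution of the mode moments
`Xᵢ(t)` with respect to `pairing`. -/
def dualStep (K : Gains N d k) :
    (Fin N → Matrix (Fin d) (Fin d) ℝ) →ₗ[ℝ] (Fin N → Matrix (Fin d) (Fin d) ℝ) where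
  toFun Y i := (S.closedLoop K i)ᵀ * S.nextMean Y i * S.closedLoop K i
  map_add' Y Z := by
    funext i
    simp [nextMean, smul_add, Finset.sum_add_distrib, Matrix.mul_add, Matrix.add_mul]
  map_smul' c Y := by
    funext i
    simp [nextMean, smul_comm _ c, ← Finset.smul_sum]

theorem dualStep_apply (K : Gains N d k) (Y : Fin N → Matrix (Fin d) (Fin d) ℝ) (i : Fin N) :
    S.dualStep K Y i = (S.closedLoop K i)ᵀ * S.nextMean Y i * S.closedLoop K i := rfl

theorem isLyapunovSolution_iff {K : Gains N d k} {Y : Fin N → Matrix (Fin d) (Fin d) ℝ} :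
    S.IsLyapunovSolution K Y ↔ Y = S.stageWeight K + S.dualStep K Y :=
  ⟨fun h => funext h, fun h i => congrFun h i⟩

theorem nextMean_transpose (Y : Fin N → Matrix (Fin d) (Fin d) ℝ) (hY : ∀ i, (Y i)ᵀ = Y i)
    (i : Fin N) : (S.nextMean Y i)ᵀ = S.nextMean Y i := by
  simp [nextMean, Matrix.transpose_sum, hY]

variable {S}

theorem posSemidef_nextMean (hp : ∀ i j, 0 ≤ S.p i j) {Y : Fin N → Matrix (Fin d) (Fin d) ℝ}
    (hY : ∀ i, (Y i).PosSemidef) (i : Fin N) : (S.nextMean Y i).PosSemidef :=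
  Matrix.posSemidef_sum _ fun j _ => (hY j).smul_nonneg (hp i j)

theorem posSemidef_dualStep (hp : ∀ i j, 0 ≤ S.p i j) (K : Gains N d k)
    {Y : Fin N → Matrix (Fin d) (Fin d) ℝ} (hY : ∀ i, (Y i).PosSemidef) (i : Fin N) :
    (S.dualStep K Y i).PosSemidef :=
  (posSemidef_nextMean hp hY i).transpose_mul_mul_same _

theorem posSemidef_dualStep_pow (hp : ∀ i j, 0 ≤ S.p i j) (K : Gains N d k)
    {Y : Fin N → Matrix (Fin d) (Fin d) ℝ} (hY : ∀ i, (Y i).PosSemidef) (t : ℕ) (i : Fin N) :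
    ((S.dualStep K ^ t) Y i).PosSemidef := by
  induction t generalizing i with
  | zero => exact hY i
  | succ t ih =>
    rw [pow_succ', Module.End.mul_apply]
    exact posSemidef_dualStep hp K ih i

theorem dotProduct_dualStep_mulVec (K : Gains N d k) (Z : Fin N → Matrix (Fin d) (Fin d) ℝ)
    (i : Fin N) (u v : Fin d → ℝ) :
    u ⬝ᵥ (S.dualStep K Z i *ᵥ v)
      = ∑ j, S.p i j * ((S.closedLoop K i *ᵥ u) ⬝ᵥ (Z j *ᵥ (S.closedLoop K i *ᵥ v))) := by
  rw [dualStep_apply, ← Matrix.mulVec_mulVec, ← Matrix.mulVec_mulVec, Matrix.dotProduct_mulVec,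
    Matrix.vecMul_transpose, nextMean, Matrix.sum_mulVec, dotProduct_sum]
  simp [Matrix.smul_mulVec]

theorem posDef_stageWeight (hQ : ∀ i, (S.Q i).PosDef) (hR : ∀ i, (S.R i).PosDef)
    (K : Gains N d k) (i : Fin N) : (S.stageWeight K i).PosDef :=
  (hQ i).add_posSemidef ((hR i).posSemidef.transpose_mul_mul_same _)

/-! ### Stability of the closed loop -/

/-- `K` is stable if the iterates of `S.dualStep K` tend to `0`. All families of matrices are
admitted, not only symmetric ones, so that the Lyapunov equations have a unique solution among
arbitrary matrices. -/
def IsStable (S : JumpSystem N d k) (K : Gains N d k) : Prop :=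
  ∀ Z, Tendsto (fun t => (S.dualStep K ^ t) Z) atTop (𝓝 0)

/-- The iterates on the identity control the iterates on all families of matrices, also
nonsymmetric ones. -/
theorem abs_bilin_dualStep_pow_le (hp : ∀ i j, 0 ≤ S.p i j) (K : Gains N d k)
    {Z : Fin N → Matrix (Fin d) (Fin d) ℝ} {c : ℝ}
    (hZ : ∀ i u v, |u ⬝ᵥ (Z i *ᵥ v)| ≤ c * (u ⬝ᵥ u + v ⬝ᵥ v)) (t : ℕ) (i : Fin N)
    (u v : Fin d → ℝ) :
    |u ⬝ᵥ ((S.dualStep K ^ t) Z i *ᵥ v)| ≤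
      c * (u ⬝ᵥ ((S.dualStep K ^ t) 1 i *ᵥ u) + v ⬝ᵥ ((S.dualStep K ^ t) 1 i *ᵥ v)) := by
  induction t generalizing i u v with
  | zero => simpa using hZ i u v
  | succ t ih =>
    simp only [pow_succ', Module.End.mul_apply, dotProduct_dualStep_mulVec]
    refine (Finset.abs_sum_le_sum_abs _ _).trans ?_
    rw [← Finset.sum_add_distrib, Finset.mul_sum]
    refine Finset.sum_le_sum fun j _ => ?_
    rw [abs_mul, abs_of_nonneg (hp i j)]
    have := mul_le_mul_of_nonneg_left (ih j (S.closedLoop K i *ᵥ u) (S.closedLoop K i *ᵥ v))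
      (hp i j)
    linarith

theorem isStable_of_tendsto_trace (hp : ∀ i j, 0 ≤ S.p i j) {K : Gains N d k}
    (h : ∀ i, Tendsto (fun t => ((S.dualStep K ^ t) 1 i).trace) atTop (𝓝 0)) :
    S.IsStable K := by
  intro Z
  -- `Z` is dominated by `c` times the identity, and the domination persists under iteration
  set c := ∑ i, absSum (Z i) with hc
  have hc0 : 0 ≤ c := Finset.sum_nonneg fun i _ => absSum_nonneg _
  have hZ : ∀ i u v, |u ⬝ᵥ (Z i *ᵥ v)| ≤ c * (u ⬝ᵥ u + v ⬝ᵥ v) := fun i u v =>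
    (abs_bilin_le (Z i) u v).trans <| mul_le_mul_of_nonneg_right
      (Finset.single_le_sum (f := fun i => absSum (Z i)) (fun i _ => absSum_nonneg _)
        (Finset.mem_univ i))
      (add_nonneg (Finset.sum_nonneg fun _ _ => mul_self_nonneg _)
        (Finset.sum_nonneg fun _ _ => mul_self_nonneg _))
  rw [tendsto_pi_nhds]
  refine fun i => tendsto_matrix fun a b => ?_
  refine squeeze_zero_norm (a := fun t => c * (2 * ((S.dualStep K ^ t) 1 i).trace)) (fun t => ?_) ?_
  · have h1 := abs_bilin_dualStep_pow_le hp K hZ t i (Pi.single a 1) (Pi.single b 1)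
    have hpsd : ((S.dualStep K ^ t) 1 i).PosSemidef :=
      posSemidef_dualStep_pow hp K (fun _ => Matrix.PosSemidef.one) t i
    have ha := (abs_le.1 (abs_entry_le_trace hpsd a a)).2
    have hb := (abs_le.1 (abs_entry_le_trace hpsd b b)).2
    simp at h1
    rw [Real.norm_eq_abs]
    nlinarith
  · simpa using ((h i).const_mul 2).const_mul c

theorem sub_dualStep_pow_eq (K : Gains N d k) (Y : Fin N → Matrix (Fin d) (Fin d) ℝ) (t : ℕ) :
    Y - (S.dualStep K ^ t) Y = ∑ s ∈ Finset.range t, (S.dualStep K ^ s) (Y - S.dualStep K Y) := by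
  induction t with
  | zero => simp
  | succ t ih =>
    rw [Finset.sum_range_succ, ← ih, map_sub, pow_succ, Module.End.mul_apply]
    abel

/-- A strict Lyapunov inequality certifies stability. -/
theorem isStable_of_lyapunov_inequality (hp : ∀ i j, 0 ≤ S.p i j) {K : Gains N d k}
    {Y : Fin N → Matrix (Fin d) (Fin d) ℝ} (hY : ∀ i, (Y i).PosSemidef) {c : ℝ} (hc : 0 < c)
    (h : ∀ i, (Y i - S.dualStep K Y i - c • (1 : Matrix (Fin d) (Fin d) ℝ)).PosSemidef) :
    S.IsStable K := by
  refine isStable_of_tendsto_trace hp fun i => ?_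
  -- the traces are summable: `c ∑ₛ (dualStep K)ˢ 1` telescopes to at most `Y`
  refine Summable.tendsto_atTop_zero (summable_of_sum_range_le (c := (Y i).trace / c)
    (fun t => (posSemidef_dualStep_pow hp K (fun _ => Matrix.PosSemidef.one) t i).trace_nonneg)
    fun t => ?_)
  rw [le_div_iff₀ hc]
  have h1 := (posSemidef_dualStep_pow hp K hY t i).trace_nonneg
  have h2 : ∀ s, c * ((S.dualStep K ^ s) 1 i).trace
      ≤ ((S.dualStep K ^ s) (Y - S.dualStep K Y) i).trace := by
    intro s
    have := (posSemidef_dualStep_pow hp K (Y := Y - S.dualStep K Y - c • 1)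
      (fun i => h i) s i).trace_nonneg
    rw [map_sub, map_smul] at this
    simp only [Pi.sub_apply, Pi.smul_apply, Matrix.trace_sub, Matrix.trace_smul,
      smul_eq_mul] at this
    linarith
  have h3 := congrArg Matrix.trace (congrFun (sub_dualStep_pow_eq (S := S) K Y t) i)
  rw [Finset.sum_apply, Matrix.trace_sum, Pi.sub_apply, Matrix.trace_sub] at h3
  rw [mul_comm, Finset.mul_sum]
  have h4 := Finset.sum_le_sum fun s (_ : s ∈ Finset.range t) => h2 s
  linarith

theorem IsStable.eq_zero_of_dualStep_eq {K : Gains N d k} (hK : S.IsStable K)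
    {Z : Fin N → Matrix (Fin d) (Fin d) ℝ} (hZ : S.dualStep K Z = Z) : Z = 0 := by
  have h : ∀ t, (S.dualStep K ^ t) Z = Z := by
    intro t
    induction t with
    | zero => rfl
    | succ t ih => rw [pow_succ, Module.End.mul_apply, hZ, ih]
  have := hK Z
  simp only [h] at this
  exact tendsto_nhds_unique tendsto_const_nhds this

/-- `1 - dualStep K` is injective, hence surjective, on a finite-dimensional space. -/
theorem IsStable.exists_sub_dualStep_eq {K : Gains N d k} (hK : S.IsStable K)
    (V : Fin N → Matrix (Fin d) (Fin d) ℝ) : ∃ Z, Z - S.dualStep K Z = V := by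
  have hinj : Function.Injective
      ((LinearMap.id : (Fin N → Matrix (Fin d) (Fin d) ℝ) →ₗ[ℝ] _) - S.dualStep K) := by
    rw [← LinearMap.ker_eq_bot, LinearMap.ker_eq_bot']
    intro Z hZ
    rw [LinearMap.sub_apply, LinearMap.id_apply, sub_eq_zero] at hZ
    exact hK.eq_zero_of_dualStep_eq hZ.symm
  obtain ⟨Z, hZ⟩ := LinearMap.surjective_of_injective hinj V
  exact ⟨Z, hZ⟩

theorem IsStable.posSemidef_of_sub_dualStep (hp : ∀ i j, 0 ≤ S.p i j) {K : Gains N d k}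
    (hK : S.IsStable K) {Y : Fin N → Matrix (Fin d) (Fin d) ℝ}
    (h : ∀ i, (Y i - S.dualStep K Y i).PosSemidef) (i : Fin N) : (Y i).PosSemidef := by
  have hlim : Tendsto (fun t => (Y - (S.dualStep K ^ t) Y) i) atTop (𝓝 (Y i)) := by
    have := (tendsto_const_nhds (x := Y)).sub (hK Y)
    rw [sub_zero] at this
    exact (tendsto_pi_nhds.1 this) i
  refine isClosed_posSemidef.mem_of_tendsto hlim (Eventually.of_forall fun t => ?_)
  rw [sub_dualStep_pow_eq, Finset.sum_apply]
  exact Matrix.posSemidef_sum _ fun s _ => posSemidef_dualStep_pow hp K (fun j => h j) s i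

theorem IsStable.existsUnique_lyapunov {K : Gains N d k} (hK : S.IsStable K) :
    ∃! Y, S.IsLyapunovSolution K Y := by
  obtain ⟨Y, hY⟩ := hK.exists_sub_dualStep_eq (S.stageWeight K)
  refine ⟨Y, S.isLyapunovSolution_iff.2 (by rw [← hY]; abel), fun Z hZ => ?_⟩
  dsimp only at hZ
  rw [S.isLyapunovSolution_iff, ← hY] at hZ
  rw [← sub_eq_zero]
  refine hK.eq_zero_of_dualStep_eq ?_
  rw [map_sub, sub_eq_sub_iff_sub_eq_sub]
  have := hZ
  rw [add_comm, ← sub_eq_iff_eq_add'] at this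
  rw [← neg_sub, this]
  abel

theorem IsStable.lyapunov_spec {K : Gains N d k} (hK : S.IsStable K) :
    S.IsLyapunovSolution K (S.lyapunov K) := by
  have h := hK.existsUnique_lyapunov.exists
  rw [lyapunov, dif_pos h]
  exact h.choose_spec

theorem IsStable.lyapunov_eq {K : Gains N d k} (hK : S.IsStable K)
    {Y : Fin N → Matrix (Fin d) (Fin d) ℝ} (hY : S.IsLyapunovSolution K Y) :
    S.lyapunov K = Y :=
  hK.existsUnique_lyapunov.unique hK.lyapunov_spec hY

theorem IsStable.sub_dualStep_lyapunov {K : Gains N d k} (hK : S.IsStable K) :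
    S.lyapunov K - S.dualStep K (S.lyapunov K) = S.stageWeight K :=
  sub_eq_of_eq_add (S.isLyapunovSolution_iff.1 hK.lyapunov_spec)

theorem IsStable.posSemidef_lyapunov (hp : ∀ i j, 0 ≤ S.p i j) (hQ : ∀ i, (S.Q i).PosDef)
    (hR : ∀ i, (S.R i).PosDef) {K : Gains N d k} (hK : S.IsStable K) (i : Fin N) :
    (S.lyapunov K i).PosSemidef := by
  refine hK.posSemidef_of_sub_dualStep hp (fun i => ?_) i
  rw [← Pi.sub_apply, hK.sub_dualStep_lyapunov]
  exact (posDef_stageWeight hQ hR K i).posSemidef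

/-! ### Change of the value under a change of the gain -/

/-- `Rᵢ + Bᵢᵀ ℰᵢ(Y) Bᵢ`; this is `S.inputWeight K i` for `Y = S.lyapunov K`. -/
def weightOf (S : JumpSystem N d k) (Y : Fin N → Matrix (Fin d) (Fin d) ℝ) (i : Fin N) :
    Matrix (Fin k) (Fin k) ℝ :=
  S.R i + (S.B i)ᵀ * S.nextMean Y i * S.B i

/-- `(Rᵢ + Bᵢᵀ ℰᵢ(Y) Bᵢ) Kᵢ - Bᵢᵀ ℰᵢ(Y) Aᵢ`; this is `S.gradFactor K i` for
`Y = S.lyapunov K`. -/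
def factorOf (S : JumpSystem N d k) (Y : Fin N → Matrix (Fin d) (Fin d) ℝ) (K : Gains N d k)
    (i : Fin N) : Matrix (Fin k) (Fin d) ℝ :=
  S.weightOf Y i * K i - (S.B i)ᵀ * S.nextMean Y i * S.A i

/-- The amount `Δᵀ L + Lᵀ Δ + Δᵀ Ψ Δ`, with `Δ = K' - K`, by which changing the gain from `K` to
`K'` for a single step changes the value matrices `Y` of `K`. -/
def valueChange (S : JumpSystem N d k) (Y : Fin N → Matrix (Fin d) (Fin d) ℝ)
    (K K' : Gains N d k) (i : Fin N) : Matrix (Fin d) (Fin d) ℝ :=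
  (K' i - K i)ᵀ * S.factorOf Y K i + (S.factorOf Y K i)ᵀ * (K' i - K i)
    + (K' i - K i)ᵀ * S.weightOf Y i * (K' i - K i)

theorem weightOf_transpose (hR : ∀ i, (S.R i).PosDef) {Y : Fin N → Matrix (Fin d) (Fin d) ℝ}
    (hY : ∀ i, (Y i)ᵀ = Y i) (i : Fin N) : (S.weightOf Y i)ᵀ = S.weightOf Y i := by
  simp [weightOf, Matrix.mul_assoc, S.nextMean_transpose Y hY, (hR i).posSemidef.transpose_eq]

theorem posDef_weightOf (hp : ∀ i j, 0 ≤ S.p i j) (hR : ∀ i, (S.R i).PosDef)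
    {Y : Fin N → Matrix (Fin d) (Fin d) ℝ} (hY : ∀ i, (Y i).PosSemidef) (i : Fin N) :
    (S.weightOf Y i).PosDef :=
  (hR i).add_posSemidef ((posSemidef_nextMean hp hY i).transpose_mul_mul_same _)

theorem stageWeight_add_dualStep_sub (hR : ∀ i, (S.R i).PosDef)
    {Y : Fin N → Matrix (Fin d) (Fin d) ℝ} (hYs : ∀ i, (Y i)ᵀ = Y i) (K K' : Gains N d k)
    (i : Fin N) :
    (S.stageWeight K' i + S.dualStep K' Y i) - (S.stageWeight K i + S.dualStep K Y i)
      = S.valueChange Y K K' i := by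
  obtain ⟨D, hD⟩ : ∃ D, K' i = K i + D := ⟨K' i - K i, by abel⟩
  simp only [stageWeight, dualStep_apply, closedLoop, valueChange, factorOf, weightOf, hD,
    add_sub_cancel_left, Matrix.transpose_sub, Matrix.transpose_add, Matrix.transpose_mul,
    Matrix.transpose_transpose, S.nextMean_transpose Y hYs, (hR i).posSemidef.transpose_eq,
    Matrix.mul_add, Matrix.add_mul, Matrix.mul_sub, Matrix.sub_mul, Matrix.mul_assoc]
  abel

theorem IsLyapunovSolution.valueChange_eq (hR : ∀ i, (S.R i).PosDef) {K : Gains N d k}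
    {Y : Fin N → Matrix (Fin d) (Fin d) ℝ} (hY : S.IsLyapunovSolution K Y)
    (hYs : ∀ i, (Y i)ᵀ = Y i) (K' : Gains N d k) :
    S.stageWeight K' + S.dualStep K' Y - Y = S.valueChange Y K K' := by
  funext i
  rw [← stageWeight_add_dualStep_sub hR hYs]
  simp only [Pi.add_apply, Pi.sub_apply]
  congr 1
  exact congrFun (S.isLyapunovSolution_iff.1 hY) i

end JumpSystem

/-! ### Functions of the mode path -/

section Paths

variable {N : ℕ}

/-- A function of mode paths that depends only on the modes up to time `t`. -/
def IsAdaptedAt (h : (ℕ → Fin N) → ℝ) (t : ℕ) : Prop :=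
  ∀ π π' : ℕ → Fin N, (∀ s ≤ t, π s = π' s) → h π = h π'

/-- Extension of a finite mode path to all times; the values after time `t` are arbitrary. -/
def extendPath {t : ℕ} (π : Fin (t + 1) → Fin N) : ℕ → Fin N := fun s => π (Fin.ofNat (t + 1) s)

theorem extendPath_of_le {t s : ℕ} (π : Fin (t + 1) → Fin N) (hs : s ≤ t) :
    extendPath π s = π ⟨s, Nat.lt_succ_of_le hs⟩ := by
  have : Fin.ofNat (t + 1) s = ⟨s, Nat.lt_succ_of_le hs⟩ :=
    Fin.ext (Nat.mod_eq_of_lt (Nat.lt_succ_of_le hs))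
  rw [extendPath, this]

theorem IsAdaptedAt.measurable {h : (ℕ → Fin N) → ℝ} {t : ℕ} (hh : IsAdaptedAt h t) :
    Measurable h := by
  have : h = (fun π : Fin (t + 1) → Fin N => h (extendPath π)) ∘
      fun (π : ℕ → Fin N) (s : Fin (t + 1)) => π s := by
    funext π
    refine hh _ _ fun s hs => ?_
    rw [extendPath_of_le _ hs]
  rw [this]
  exact Measurable.of_discrete.comp
    (measurable_pi_lambda _ fun s => measurable_pi_apply _)

variable {Ω : Type*} {ω : ℕ → Ω → Fin N}

/-- Decomposition of a function of the past, times an indicator, over the finitely many paths up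
to time `t`. -/
theorem path_mul_indicator_eq_sum {h : (ℕ → Fin N) → ℝ} {t : ℕ} (hh : IsAdaptedAt h t)
    (E : Set Ω) (w : Ω) :
    h (fun s => ω s w) * E.indicator 1 w = ∑ π : Fin (t + 1) → Fin N, h (extendPath π) *
      ({w | ∀ s ≤ t, ω s w = extendPath π s} ∩ E).indicator 1 w := by
  rw [Finset.sum_eq_single fun s : Fin (t + 1) => ω s w]
  · have h1 : ∀ s ≤ t, ω s w = extendPath (fun s : Fin (t + 1) => ω s w) s := fun s hs => by
      rw [extendPath_of_le _ hs]
    have h2 : w ∈ {w' | ∀ s ≤ t, ω s w' = extendPath (fun s : Fin (t + 1) => ω s w) s} := h1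
    rw [hh _ _ h1]
    by_cases hE : w ∈ E
    · rw [Set.indicator_of_mem hE, Set.indicator_of_mem (Set.mem_inter h2 hE)]
    · rw [Set.indicator_of_notMem hE, Set.indicator_of_notMem fun hw => hE hw.2]
  · intro π _ hπ
    rw [Set.indicator_of_notMem, mul_zero]
    rintro ⟨hw, -⟩
    refine hπ (funext fun s => ?_)
    have := hw s (Nat.lt_succ_iff.1 s.2)
    rw [extendPath_of_le _ (Nat.lt_succ_iff.1 s.2)] at this
    exact this.symm
  · intro hcon
    exact absurd (Finset.mem_univ _) hcon

variable [MeasurableSpace Ω] {P : Measure Ω} [IsProbabilityMeasure P]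

theorem measurableSet_path (hω : ∀ t, Measurable (ω t)) (t : ℕ) (π : ℕ → Fin N) :
    MeasurableSet {w | ∀ s ≤ t, ω s w = π s} := by
  have : {w | ∀ s ≤ t, ω s w = π s} = ⋂ s ∈ Set.Iic t, ω s ⁻¹' {π s} := by
    ext w; simp
  rw [this]
  exact MeasurableSet.biInter (Set.to_countable _) fun s _ => hω s (measurableSet_singleton _)

theorem integral_path_mul_indicator (hω : ∀ t, Measurable (ω t)) {h : (ℕ → Fin N) → ℝ} {t : ℕ}
    (hh : IsAdaptedAt h t) {E : Set Ω} (hE : MeasurableSet E) :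
    ∫ w, h (fun s => ω s w) * E.indicator 1 w ∂P = ∑ π : Fin (t + 1) → Fin N,
      h (extendPath π) * P.real ({w | ∀ s ≤ t, ω s w = extendPath π s} ∩ E) := by
  simp_rw [path_mul_indicator_eq_sum hh]
  have hm : ∀ π : Fin (t + 1) → Fin N,
      MeasurableSet ({w | ∀ s ≤ t, ω s w = extendPath π s} ∩ E) :=
    fun π => (measurableSet_path hω t _).inter hE
  have hint : ∀ π : Fin (t + 1) → Fin N, Integrable
      (({w | ∀ s ≤ t, ω s w = extendPath π s} ∩ E).indicator (1 : Ω → ℝ)) P :=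
    fun π => (integrable_const (1 : ℝ)).indicator (hm π)
  rw [integral_finsetSum _ fun π _ => (hint π).const_mul _]
  refine Finset.sum_congr rfl fun π _ => ?_
  rw [integral_const_mul, integral_indicator_one (hm π)]

theorem integrable_path (hω : ∀ t, Measurable (ω t)) {h : (ℕ → Fin N) → ℝ} {t : ℕ}
    (hh : IsAdaptedAt h t) : Integrable (fun w => h (fun s => ω s w)) P := by
  have : (fun w => h (fun s => ω s w)) = fun w => ∑ π : Fin (t + 1) → Fin N, h (extendPath π) *
      ({w | ∀ s ≤ t, ω s w = extendPath π s} ∩ Set.univ).indicator 1 w := by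
    funext w
    rw [← path_mul_indicator_eq_sum hh Set.univ w]
    simp
  rw [this]
  refine integrable_finsetSum _ fun π _ =>
    ((integrable_const (1 : ℝ)).indicator ?_).const_mul _
  exact (measurableSet_path hω t _).inter MeasurableSet.univ

/-- The Markov property: conditionally on the past, the next mode is `j` with probability
`p (ω t) j`. -/
theorem IsMarkovChain.integral_next {ρ : Fin N → ℝ} {p : Fin N → Fin N → ℝ}
    (hω : IsMarkovChain P ω ρ p) {h : (ℕ → Fin N) → ℝ} {t : ℕ} (hh : IsAdaptedAt h t)
    (j : Fin N) :
    ∫ w, h (fun s => ω s w) * {w | ω (t + 1) w = j}.indicator 1 w ∂P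
      = ∫ w, h (fun s => ω s w) * p (ω t w) j ∂P := by
  have hE : MeasurableSet {w | ω (t + 1) w = j} :=
    hω.measurable _ (measurableSet_singleton j)
  have h2 : IsAdaptedAt (fun π => h π * p (π t) j) t := fun π π' hπ => by
    simp only [hh π π' hπ, hπ t le_rfl]
  have h3 := integral_path_mul_indicator (P := P) hω.measurable h2 MeasurableSet.univ
  simp only [Set.indicator_univ, Pi.one_apply, mul_one, Set.inter_univ] at h3
  rw [integral_path_mul_indicator hω.measurable hh hE, h3]
  refine Finset.sum_congr rfl fun π _ => ?_
  rw [mul_assoc]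
  congr 1
  rw [mul_comm (p _ _)]
  exact hω.step t (extendPath π) j

end Paths

namespace JumpSystem

/-! ### Second moments of the closed loop -/

section Moments

variable {N d k : ℕ} (S : JumpSystem N d k)

/-- The transition matrix from time `0` to time `t` of the closed loop along a mode path. -/
noncomputable def transition (K : Gains N d k) (π : ℕ → Fin N) : ℕ → Matrix (Fin d) (Fin d) ℝ
  | 0 => 1
  | t + 1 => S.closedLoop K (π t) * transition K π t

theorem transition_congr (K : Gains N d k) {π π' : ℕ → Fin N} {t : ℕ}
    (h : ∀ s < t, π s = π' s) : S.transition K π t = S.transition K π' t := by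
  induction t with
  | zero => rfl
  | succ t ih =>
    rw [transition, transition, ih fun s hs => h s (hs.trans (Nat.lt_succ_self t)),
      h t (Nat.lt_succ_self t)]

variable {Ω : Type*} (ω : ℕ → Ω → Fin N) (x₀ : Ω → Fin d → ℝ) (K : Gains N d k)

theorem state_succ (t : ℕ) (w : Ω) :
    S.state ω x₀ K (t + 1) w = S.closedLoop K (ω t w) *ᵥ S.state ω x₀ K t w := by
  simp only [state, closedLoop, Matrix.sub_mulVec, Matrix.mulVec_neg, Matrix.mulVec_mulVec]
  abel

theorem state_eq_transition_mulVec (t : ℕ) (w : Ω) :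
    S.state ω x₀ K t w = S.transition K (fun s => ω s w) t *ᵥ x₀ w := by
  induction t with
  | zero => simp [state, transition]
  | succ t ih => rw [state_succ, ih, transition, Matrix.mulVec_mulVec]

theorem stageCost_eq (t : ℕ) (w : Ω) :
    S.stageCost ω x₀ K t w = S.state ω x₀ K t w ⬝ᵥ
      (S.stageWeight K (ω t w) *ᵥ S.state ω x₀ K t w) := by
  simp only [stageCost, input, stageWeight, Matrix.add_mulVec, dotProduct_add, Matrix.mulVec_neg,
    neg_dotProduct_neg, ← Matrix.mulVec_mulVec]
  rw [Matrix.dotProduct_mulVec (S.state ω x₀ K t w) (K (ω t w))ᵀ, Matrix.vecMul_transpose]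

variable {ω}

/-- Decomposition of a function of the current mode over the modes. -/
theorem eq_sum_indicator (t : ℕ) (f : Fin N → Ω → ℝ) :
    (fun w => f (ω t w) w) = fun w => ∑ i, {w | ω t w = i}.indicator (f i) w := by
  funext w
  rw [Finset.sum_eq_single (ω t w)]
  · simp
  · intro i _ hi
    rw [Set.indicator_of_notMem]
    exact fun h => hi (Eq.symm h)
  · simp

variable [MeasurableSpace Ω] {P : Measure Ω} {x₀ K}
  {ρ : Fin N → ℝ}

theorem memLp_state (hω : IsMarkovChain P ω ρ S.p) (hx₀ : IsInitialState P ω x₀) (t : ℕ)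
    (a : Fin d) : MemLp (fun w => S.state ω x₀ K t w a) 2 P := by
  induction t generalizing a with
  | zero => exact hx₀.memLp.eval a
  | succ t ih =>
    have : (fun w => S.state ω x₀ K (t + 1) w a) = fun w => ∑ i, ∑ b,
        {w | ω t w = i}.indicator (fun w => S.closedLoop K i a b * S.state ω x₀ K t w b) w := by
      funext w
      rw [state_succ, Finset.sum_eq_single (ω t w)]
      · simp [Matrix.mulVec, dotProduct]
      · intro i _ hi
        refine Finset.sum_eq_zero fun b _ => Set.indicator_of_notMem (fun h => hi ?_) _
        exact Eq.symm h
      · simp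
    rw [this]
    refine memLp_finsetSum _ fun i _ => memLp_finsetSum _ fun b _ => ?_
    exact ((ih b).const_mul _).indicator (hω.measurable t (measurableSet_singleton i))

theorem integrable_state_mul (hω : IsMarkovChain P ω ρ S.p) (hx₀ : IsInitialState P ω x₀) (t : ℕ)
    (a b : Fin d) : Integrable (fun w => S.state ω x₀ K t w a * S.state ω x₀ K t w b) P :=
  (S.memLp_state hω hx₀ t a).integrable_mul (S.memLp_state hω hx₀ t b)

theorem integrable_indicator_quadratic (hω : IsMarkovChain P ω ρ S.p)
    (hx₀ : IsInitialState P ω x₀) (V : Matrix (Fin d) (Fin d) ℝ) (i : Fin N) (t : ℕ) :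
    Integrable (fun w => {w | ω t w = i}.indicator
      (fun w => S.state ω x₀ K t w ⬝ᵥ (V *ᵥ S.state ω x₀ K t w)) w) P := by
  refine Integrable.indicator ?_ (hω.measurable t (measurableSet_singleton i))
  simp only [dotProduct, Matrix.mulVec, Finset.mul_sum]
  refine integrable_finsetSum _ fun a _ => integrable_finsetSum _ fun b _ => ?_
  have := (S.integrable_state_mul (K := K) hω hx₀ t a b).const_mul (V a b)
  refine this.congr (Eventually.of_forall fun w => ?_)
  dsimp only
  ring

theorem integral_indicator_quadratic (hω : IsMarkovChain P ω ρ S.p)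
    (hx₀ : IsInitialState P ω x₀) (V : Matrix (Fin d) (Fin d) ℝ) (i : Fin N) (t : ℕ) :
    ∫ w, {w | ω t w = i}.indicator
      (fun w => S.state ω x₀ K t w ⬝ᵥ (V *ᵥ S.state ω x₀ K t w)) w ∂P
      = (V * S.modeMoment P ω x₀ K i t).trace := by
  have hE : MeasurableSet {w | ω t w = i} := hω.measurable t (measurableSet_singleton i)
  have h1 : ∀ w, {w | ω t w = i}.indicator
      (fun w => S.state ω x₀ K t w ⬝ᵥ (V *ᵥ S.state ω x₀ K t w)) w
      = ∑ a, ∑ b, V a b * {w | ω t w = i}.indicator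
        (fun w => S.state ω x₀ K t w b * S.state ω x₀ K t w a) w := by
    intro w
    by_cases hw : w ∈ {w | ω t w = i}
    · simp only [Set.indicator_of_mem hw, dotProduct, Matrix.mulVec, Finset.mul_sum]
      exact Finset.sum_congr rfl fun a _ => Finset.sum_congr rfl fun b _ => by ring
    · simp only [Set.indicator_of_notMem hw, mul_zero, Finset.sum_const_zero]
  have hint : ∀ a b, Integrable (fun w => V a b * {w | ω t w = i}.indicator
        (fun w => S.state ω x₀ K t w b * S.state ω x₀ K t w a) w) P := fun a b =>
    ((S.integrable_state_mul hω hx₀ t b a).indicator hE).const_mul _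
  simp_rw [h1]
  rw [integral_finsetSum _ fun a _ => integrable_finsetSum _ fun b _ => hint a b]
  simp only [Matrix.trace, Matrix.diag, Matrix.mul_apply]
  refine Finset.sum_congr rfl fun a _ => ?_
  rw [integral_finsetSum _ fun b _ => hint a b]
  refine Finset.sum_congr rfl fun b _ => ?_
  rw [integral_const_mul]
  rfl

theorem posSemidef_modeMoment (hω : IsMarkovChain P ω ρ S.p) (hx₀ : IsInitialState P ω x₀)
    (i : Fin N) (t : ℕ) : (S.modeMoment P ω x₀ K i t).PosSemidef := by
  refine posSemidef_of_transpose_eq ?_ fun v => ?_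
  · ext a b
    simp only [modeMoment, Matrix.transpose_apply, Matrix.of_apply]
    congr 1
    funext w
    congr 1
    funext w
    ring
  · have h1 : v ⬝ᵥ (S.modeMoment P ω x₀ K i t *ᵥ v)
        = (Matrix.vecMulVec v v * S.modeMoment P ω x₀ K i t).trace := by
      rw [Matrix.trace_mul_comm, Matrix.mul_vecMulVec, Matrix.trace_vecMulVec, dotProduct_comm]
    rw [h1, ← S.integral_indicator_quadratic hω hx₀]
    refine integral_nonneg fun w => Set.indicator_nonneg (fun w _ => ?_) w
    rw [Matrix.vecMulVec_mulVec]
    simp only [op_smul_eq_smul, dotProduct_smul, smul_eq_mul]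
    rw [dotProduct_comm v]
    exact mul_self_nonneg _

theorem integrable_quadratic (hω : IsMarkovChain P ω ρ S.p)
    (hx₀ : IsInitialState P ω x₀) (V : Fin N → Matrix (Fin d) (Fin d) ℝ) (t : ℕ) :
    Integrable (fun w => S.state ω x₀ K t w ⬝ᵥ (V (ω t w) *ᵥ S.state ω x₀ K t w)) P := by
  rw [eq_sum_indicator t fun i w => S.state ω x₀ K t w ⬝ᵥ (V i *ᵥ S.state ω x₀ K t w)]
  exact integrable_finsetSum _ fun i _ => S.integrable_indicator_quadratic hω hx₀ (V i) i t

theorem integral_quadratic (hω : IsMarkovChain P ω ρ S.p)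
    (hx₀ : IsInitialState P ω x₀) (V : Fin N → Matrix (Fin d) (Fin d) ℝ) (t : ℕ) :
    ∫ w, S.state ω x₀ K t w ⬝ᵥ (V (ω t w) *ᵥ S.state ω x₀ K t w) ∂P
      = pairing V (fun i => S.modeMoment P ω x₀ K i t) := by
  rw [eq_sum_indicator t fun i w => S.state ω x₀ K t w ⬝ᵥ (V i *ᵥ S.state ω x₀ K t w),
    integral_finsetSum _ fun i _ => S.integrable_indicator_quadratic hω hx₀ (V i) i t]
  exact Finset.sum_congr rfl fun i _ => S.integral_indicator_quadratic hω hx₀ (V i) i t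

/-- Interchange of expectation and sum; the stage costs are nonnegative. -/
theorem cost_eq_tsum (hω : IsMarkovChain P ω ρ S.p) (hx₀ : IsInitialState P ω x₀)
    (hQ : ∀ i, (S.Q i).PosDef) (hR : ∀ i, (S.R i).PosDef) :
    S.cost P ω x₀ K = ∑' t, ENNReal.ofReal
      (pairing (S.stageWeight K) (fun i => S.modeMoment P ω x₀ K i t)) := by
  have hint := fun t => S.integrable_quadratic (K := K) hω hx₀ (S.stageWeight K) t
  rw [cost]
  simp_rw [stageCost_eq]
  rw [lintegral_tsum fun t => (hint t).aestronglyMeasurable.aemeasurable.ennreal_ofReal]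
  congr 1
  funext t
  rw [← ofReal_integral_eq_lintegral_ofReal (hint t) (Eventually.of_forall fun w =>
    (posDef_stageWeight hQ hR K _).posSemidef.quadratic_nonneg _), S.integral_quadratic hω hx₀]

variable [IsProbabilityMeasure P]

theorem integrable_path_mul_initial (hω : IsMarkovChain P ω ρ S.p) (hx₀ : IsInitialState P ω x₀)
    {h : (ℕ → Fin N) → ℝ} {t : ℕ} (hh : IsAdaptedAt h t) (c e : Fin d) :
    Integrable (fun w => h (fun s => ω s w) * (x₀ w c * x₀ w e)) P := by
  have h1 : Measurable fun x : Fin d → ℝ => x c * x e := by fun_prop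
  exact (hx₀.indep.symm.comp hh.measurable h1).integrable_mul
    (integrable_path hω.measurable hh)
    ((hx₀.memLp.eval c).integrable_mul (hx₀.memLp.eval e))

theorem integral_path_mul_initial (hω : IsMarkovChain P ω ρ S.p) (hx₀ : IsInitialState P ω x₀)
    {h : (ℕ → Fin N) → ℝ} {t : ℕ} (hh : IsAdaptedAt h t) (c e : Fin d) :
    ∫ w, h (fun s => ω s w) * (x₀ w c * x₀ w e) ∂P
      = (∫ w, h (fun s => ω s w) ∂P) * secondMoment P x₀ c e := by
  have h1 : Measurable fun x : Fin d → ℝ => x c * x e := by fun_prop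
  exact (hx₀.indep.symm.comp hh.measurable h1).integral_fun_mul_eq_mul_integral
    (integrable_path hω.measurable hh).aestronglyMeasurable
    ((hx₀.memLp.eval c).integrable_mul (hx₀.memLp.eval e)).aestronglyMeasurable

/-- The mode at time `t + 1`, given the past, is `j` with probability `p (ω t) j`, also when
weighted by products of components of the state at time `t + 1`. -/
theorem modeMoment_succ_apply (hω : IsMarkovChain P ω ρ S.p) (hx₀ : IsInitialState P ω x₀)
    (t : ℕ) (j : Fin N) (a b : Fin d) :
    S.modeMoment P ω x₀ K j (t + 1) a b = ∫ w, S.p (ω t w) j *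
      (S.state ω x₀ K (t + 1) w a * S.state ω x₀ K (t + 1) w b) ∂P := by
  set h : Fin d → Fin d → (ℕ → Fin N) → ℝ := fun c e π =>
    S.transition K π (t + 1) a c * S.transition K π (t + 1) b e with hdef
  have hh : ∀ c e, IsAdaptedAt (h c e) t := fun c e π π' hπ => by
    simp only [hdef, S.transition_congr K fun s hs => hπ s (Nat.lt_succ_iff.1 hs)]
  -- the state at time `t + 1` depends only on the modes up to time `t`
  have hexp : ∀ w, S.state ω x₀ K (t + 1) w a * S.state ω x₀ K (t + 1) w b
      = ∑ c, ∑ e, h c e (fun s => ω s w) * (x₀ w c * x₀ w e) := by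
    intro w
    simp only [state_eq_transition_mulVec, Matrix.mulVec, dotProduct, Finset.sum_mul_sum, hdef]
    exact Finset.sum_congr rfl fun c _ => Finset.sum_congr rfl fun e _ => by ring
  -- the indicator of the next mode, and its conditional probability, as functions of the path
  set g₁ : Fin d → Fin d → (ℕ → Fin N) → ℝ := fun c e π =>
    h c e π * (if π (t + 1) = j then 1 else 0) with hg₁
  set g₂ : Fin d → Fin d → (ℕ → Fin N) → ℝ := fun c e π => h c e π * S.p (π t) j with hg₂
  have hA₁ : ∀ c e, IsAdaptedAt (g₁ c e) (t + 1) := fun c e π π' hπ => by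
    simp only [hg₁, hh c e π π' fun s hs => hπ s (hs.trans (Nat.le_succ t)), hπ (t + 1) le_rfl]
  have hA₂ : ∀ c e, IsAdaptedAt (g₂ c e) t := fun c e π π' hπ => by
    simp only [hg₂, hh c e π π' hπ, hπ t le_rfl]
  have e₁ : ∀ w, {w | ω (t + 1) w = j}.indicator
      (fun w => S.state ω x₀ K (t + 1) w a * S.state ω x₀ K (t + 1) w b) w
      = ∑ c, ∑ e, g₁ c e (fun s => ω s w) * (x₀ w c * x₀ w e) := by
    intro w
    by_cases hw : ω (t + 1) w = j
    · rw [Set.indicator_of_mem (show w ∈ {w | ω (t + 1) w = j} from hw), hexp]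
      simp [hg₁, hw]
    · rw [Set.indicator_of_notMem (show w ∉ {w | ω (t + 1) w = j} from hw)]
      simp [hg₁, hw]
  have e₂ : ∀ w, S.p (ω t w) j *
      (S.state ω x₀ K (t + 1) w a * S.state ω x₀ K (t + 1) w b)
      = ∑ c, ∑ e, g₂ c e (fun s => ω s w) * (x₀ w c * x₀ w e) := by
    intro w
    simp only [hexp, Finset.mul_sum, hg₂]
    exact Finset.sum_congr rfl fun c _ => Finset.sum_congr rfl fun e _ => by ring
  simp only [modeMoment, Matrix.of_apply]
  simp_rw [e₁, e₂]
  rw [integral_finsetSum _ fun c _ => integrable_finsetSum _ fun e _ =>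
      S.integrable_path_mul_initial hω hx₀ (hA₁ c e) c e,
    integral_finsetSum _ fun c _ => integrable_finsetSum _ fun e _ =>
      S.integrable_path_mul_initial hω hx₀ (hA₂ c e) c e]
  refine Finset.sum_congr rfl fun c _ => ?_
  rw [integral_finsetSum _ fun e _ => S.integrable_path_mul_initial hω hx₀ (hA₁ c e) c e,
    integral_finsetSum _ fun e _ => S.integrable_path_mul_initial hω hx₀ (hA₂ c e) c e]
  refine Finset.sum_congr rfl fun e _ => ?_
  rw [S.integral_path_mul_initial hω hx₀ (hA₁ c e), S.integral_path_mul_initial hω hx₀ (hA₂ c e)]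
  congr 1
  rw [← hω.integral_next (hh c e) j]
  congr 1
  funext w
  by_cases hw : ω (t + 1) w = j
  · rw [Set.indicator_of_mem (show w ∈ {w | ω (t + 1) w = j} from hw)]
    simp [hg₁, hw]
  · rw [Set.indicator_of_notMem (show w ∉ {w | ω (t + 1) w = j} from hw)]
    simp [hg₁, hw]

/-- `dualStep` is the adjoint of the evolution of the mode moments. -/
theorem pairing_modeMoment_succ (hω : IsMarkovChain P ω ρ S.p) (hx₀ : IsInitialState P ω x₀)
    (Y : Fin N → Matrix (Fin d) (Fin d) ℝ) (t : ℕ) :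
    pairing Y (fun i => S.modeMoment P ω x₀ K i (t + 1))
      = pairing (S.dualStep K Y) (fun i => S.modeMoment P ω x₀ K i t) := by
  rw [← S.integral_quadratic hω hx₀ (S.dualStep K Y) t]
  have h1 : ∀ w, S.state ω x₀ K t w ⬝ᵥ (S.dualStep K Y (ω t w) *ᵥ S.state ω x₀ K t w)
      = ∑ j, ∑ a, ∑ b, Y j a b * (S.p (ω t w) j *
        (S.state ω x₀ K (t + 1) w b * S.state ω x₀ K (t + 1) w a)) := by
    intro w
    rw [dotProduct_dualStep_mulVec, ← state_succ]
    refine Finset.sum_congr rfl fun j _ => ?_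
    simp only [dotProduct, Matrix.mulVec, Finset.mul_sum]
    exact Finset.sum_congr rfl fun a _ => Finset.sum_congr rfl fun b _ => by ring
  have hint : ∀ j a b, Integrable (fun w => Y j a b * (S.p (ω t w) j *
        (S.state ω x₀ K (t + 1) w b * S.state ω x₀ K (t + 1) w a))) P := by
    intro j a b
    refine Integrable.const_mul ?_ _
    rw [eq_sum_indicator t fun i w => S.p i j *
        (S.state ω x₀ K (t + 1) w b * S.state ω x₀ K (t + 1) w a)]
    exact integrable_finsetSum _ fun i _ => ((S.integrable_state_mul hω hx₀ (t + 1) b a).const_mul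
      _).indicator (hω.measurable t (measurableSet_singleton i))
  simp_rw [h1]
  rw [integral_finsetSum _ fun j _ => integrable_finsetSum _ fun a _ =>
    integrable_finsetSum _ fun b _ => hint j a b]
  refine Finset.sum_congr rfl fun j _ => ?_
  rw [integral_finsetSum _ fun a _ => integrable_finsetSum _ fun b _ => hint j a b]
  simp only [Matrix.trace, Matrix.diag, Matrix.mul_apply]
  refine Finset.sum_congr rfl fun a _ => ?_
  rw [integral_finsetSum _ fun b _ => hint j a b]
  refine Finset.sum_congr rfl fun b _ => ?_
  rw [integral_const_mul, S.modeMoment_succ_apply hω hx₀]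

theorem pairing_modeMoment (hω : IsMarkovChain P ω ρ S.p) (hx₀ : IsInitialState P ω x₀)
    (Y : Fin N → Matrix (Fin d) (Fin d) ℝ) (t : ℕ) :
    pairing Y (fun i => S.modeMoment P ω x₀ K i t)
      = pairing ((S.dualStep K ^ t) Y) (fun i => S.modeMoment P ω x₀ K i 0) := by
  induction t generalizing Y with
  | zero => rfl
  | succ t ih => rw [S.pairing_modeMoment_succ hω hx₀, ih, pow_succ, Module.End.mul_apply]

theorem modeMoment_zero (hω : IsMarkovChain P ω ρ S.p) (hx₀ : IsInitialState P ω x₀)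
    (i : Fin N) : S.modeMoment P ω x₀ K i 0 = ρ i • secondMoment P x₀ := by
  ext a b
  set h : (ℕ → Fin N) → ℝ := fun π => if π 0 = i then 1 else 0 with hdef
  have hh : IsAdaptedAt h 0 := fun π π' hπ => by simp only [hdef, hπ 0 le_rfl]
  have e₁ : ∀ w, {w | ω 0 w = i}.indicator
      (fun w => S.state ω x₀ K 0 w a * S.state ω x₀ K 0 w b) w
      = h (fun s => ω s w) * (x₀ w a * x₀ w b) := by
    intro w
    by_cases hw : ω 0 w = i
    · rw [Set.indicator_of_mem (show w ∈ {w | ω 0 w = i} from hw)]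
      simp [hdef, hw, state]
    · rw [Set.indicator_of_notMem (show w ∉ {w | ω 0 w = i} from hw)]
      simp [hdef, hw]
  simp only [modeMoment, Matrix.of_apply, Matrix.smul_apply, smul_eq_mul]
  simp_rw [e₁]
  have e₂ : ∫ w, h (fun s => ω s w) ∂P = ρ i := by
    have hE : MeasurableSet {w | ω 0 w = i} := hω.measurable 0 (measurableSet_singleton i)
    rw [← hω.init i, ← integral_indicator_one hE]
    congr 1
    funext w
    by_cases hw : ω 0 w = i
    · rw [Set.indicator_of_mem (show w ∈ {w | ω 0 w = i} from hw)]
      simp [hdef, hw]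
    · rw [Set.indicator_of_notMem (show w ∉ {w | ω 0 w = i} from hw)]
      simp [hdef, hw]
  rw [S.integral_path_mul_initial hω hx₀ hh, e₂]

end Moments

end JumpSystem

/-! ### The standing assumptions -/

namespace JumpSystem

/-- The standing assumptions on the system, the mode process and the initial state: positive
definite weights and second moment of the initial state, and an initial distribution that charges
all modes. -/
structure IsRegular {N d k : ℕ} {Ω : Type*} [MeasurableSpace Ω] (S : JumpSystem N d k)
    (P : Measure Ω) (ω : ℕ → Ω → Fin N) (x₀ : Ω → Fin d → ℝ) (ρ : Fin N → ℝ) : Prop where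
  modes_nonempty : Nonempty (Fin N)
  state_nonempty : Nonempty (Fin d)
  input_nonempty : Nonempty (Fin k)
  posDef_Q : ∀ i, (S.Q i).PosDef
  posDef_R : ∀ i, (S.R i).PosDef
  p_nonneg : ∀ i j, 0 ≤ S.p i j
  p_sum : ∀ i, ∑ j, S.p i j = 1
  rho_pos : ∀ i, 0 < ρ i
  isProbabilityMeasure : IsProbabilityMeasure P
  chain : IsMarkovChain P ω ρ S.p
  initial : IsInitialState P ω x₀
  posDef_secondMoment : (secondMoment P x₀).PosDef

variable {N d k : ℕ} {Ω : Type*} [MeasurableSpace Ω] {S : JumpSystem N d k}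
  {P : Measure Ω} {ω : ℕ → Ω → Fin N} {x₀ : Ω → Fin d → ℝ} {ρ : Fin N → ℝ}
  {K K' : Gains N d k}

/-- The mode moments `ρᵢ E[x₀ x₀ᵀ]` at time `0`. -/
noncomputable def initialMoment (P : Measure Ω) (x₀ : Ω → Fin d → ℝ) (ρ : Fin N → ℝ) (i : Fin N) :
    Matrix (Fin d) (Fin d) ℝ := ρ i • secondMoment P x₀

namespace IsRegular

variable (H : S.IsRegular P ω x₀ ρ)
include H

theorem modeMoment_zero_eq : (fun i => S.modeMoment P ω x₀ K i 0) = initialMoment P x₀ ρ :=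
  funext fun i => by
    have := H.isProbabilityMeasure
    exact S.modeMoment_zero H.chain H.initial i

theorem pairing_modeMoment (Y : Fin N → Matrix (Fin d) (Fin d) ℝ) (t : ℕ) :
    pairing Y (fun i => S.modeMoment P ω x₀ K i t)
      = pairing ((S.dualStep K ^ t) Y) (initialMoment P x₀ ρ) := by
  have := H.isProbabilityMeasure
  rw [S.pairing_modeMoment H.chain H.initial, H.modeMoment_zero_eq]

theorem posSemidef_modeMoment (i : Fin N) (t : ℕ) :
    (S.modeMoment P ω x₀ K i t).PosSemidef :=
  S.posSemidef_modeMoment H.chain H.initial i t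

theorem posDef_initialMoment (i : Fin N) : (initialMoment P x₀ ρ i).PosDef :=
  H.posDef_secondMoment.smul (H.rho_pos i)

theorem mu_pos : 0 < mu P ρ x₀ := by
  have := H.modes_nonempty
  have := H.state_nonempty
  refine mul_pos ?_ (sigmaMin_pos H.posDef_secondMoment)
  obtain ⟨i, hi⟩ := exists_eq_ciInf_of_finite (f := ρ)
  rw [← hi]
  exact H.rho_pos i

theorem posSemidef_initialMoment_sub_mu (i : Fin N) :
    (initialMoment P x₀ ρ i - mu P ρ x₀ • (1 : Matrix (Fin d) (Fin d) ℝ)).PosSemidef := by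
  have h1 : (ρ i • (secondMoment P x₀
      - sigmaMin (secondMoment P x₀) • (1 : Matrix (Fin d) (Fin d) ℝ))).PosSemidef :=
    (posSemidef_sub_sigmaMin H.posDef_secondMoment).smul_nonneg (H.rho_pos i).le
  have h2 : (((ρ i - ⨅ j, ρ j) * sigmaMin (secondMoment P x₀)) •
      (1 : Matrix (Fin d) (Fin d) ℝ)).PosSemidef :=
    Matrix.PosSemidef.one.smul_nonneg (mul_nonneg
      (sub_nonneg.2 (ciInf_le (Set.finite_range ρ).bddBelow i)) (sigmaMin_nonneg _))
  convert! h1.add h2 using 1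
  rw [initialMoment, mu, smul_sub, smul_smul, sub_mul, sub_smul]
  abel

theorem mu_mul_pairing_one_le {Y : Fin N → Matrix (Fin d) (Fin d) ℝ}
    (hY : ∀ i, (Y i).PosSemidef) :
    mu P ρ x₀ * pairing 1 Y ≤ pairing Y (initialMoment P x₀ ρ) := by
  have := pairing_le_right (A := mu P ρ x₀ • 1) (B := initialMoment P x₀ ρ) (X := Y)
    (fun i => H.posSemidef_initialMoment_sub_mu i) hY
  rwa [pairing_smul_right, pairing_one_right, ← pairing_one_left] at this

theorem sigmaMin_Q_pos : 0 < sigmaMin (Matrix.blockDiagonal S.Q) := by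
  have := H.modes_nonempty
  have := H.state_nonempty
  exact sigmaMin_pos (posDef_blockDiagonal H.posDef_Q)

theorem sigmaMin_R_pos : 0 < sigmaMin (Matrix.blockDiagonal S.R) := by
  have := H.modes_nonempty
  have := H.input_nonempty
  exact sigmaMin_pos (posDef_blockDiagonal H.posDef_R)

theorem posSemidef_stageWeight_sub (K : Gains N d k) (i : Fin N) :
    (S.stageWeight K i - sigmaMin (Matrix.blockDiagonal S.Q) •
      (1 : Matrix (Fin d) (Fin d) ℝ)).PosSemidef := by
  convert! (posSemidef_block_sub_sigmaMin H.posDef_Q i).add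
    ((H.posDef_R i).posSemidef.transpose_mul_mul_same (K i)) using 1
  rw [stageWeight]
  abel

/-! ### Mean square stability -/

/-- Since all modes are charged and `E[x₀ x₀ᵀ]` is positive definite, convergence of `E‖x_t‖²`
for the given process alone forces stability. -/
theorem isStable_of_tendsto
    (h : Tendsto (fun t => ∫ w, S.state ω x₀ K t w ⬝ᵥ S.state ω x₀ K t w ∂P) atTop (𝓝 0)) :
    S.IsStable K := by
  refine isStable_of_tendsto_trace H.p_nonneg fun i => ?_
  have hpsd : ∀ t i, ((S.dualStep K ^ t) 1 i).PosSemidef := fun t i =>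
    posSemidef_dualStep_pow H.p_nonneg K (fun _ => Matrix.PosSemidef.one) t i
  have h1 : ∀ t, ∫ w, S.state ω x₀ K t w ⬝ᵥ S.state ω x₀ K t w ∂P
      = pairing ((S.dualStep K ^ t) 1) (initialMoment P x₀ ρ) := by
    intro t
    rw [← H.pairing_modeMoment, ← S.integral_quadratic H.chain H.initial]
    simp
  simp_rw [h1] at h
  have h2 := h.const_mul (mu P ρ x₀)⁻¹
  rw [mul_zero] at h2
  refine squeeze_zero (fun t => (hpsd t i).trace_nonneg) (fun t => ?_) h2
  refine (trace_le_pairing_one (hpsd t) i).trans ?_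
  rw [← div_eq_inv_mul, le_div_iff₀' H.mu_pos]
  exact H.mu_mul_pairing_one_le (hpsd t)

end IsRegular

theorem IsStable.meanSquareStabilizing {S : JumpSystem N d k} {K : Gains N d k}
    (hK : S.IsStable K) : MeanSquareStabilizing.{u} S K := by
  intro Ω _ P _ ω ρ x₀ hω hx₀
  have h1 : ∀ t, ∫ w, S.state ω x₀ K t w ⬝ᵥ S.state ω x₀ K t w ∂P
      = pairing ((S.dualStep K ^ t) 1) (fun i => S.modeMoment P ω x₀ K i 0) := by
    intro t
    rw [← S.pairing_modeMoment hω hx₀, ← S.integral_quadratic hω hx₀]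
    simp
  simp_rw [h1]
  have h2 := ((continuous_pairing_left (fun i => S.modeMoment P ω x₀ K i 0)).tendsto 0).comp
    (hK 1)
  have h3 : pairing 0 (fun i => S.modeMoment P ω x₀ K i 0) = 0 := by simp [pairing]
  rwa [h3] at h2

theorem IsRegular.meanSquareStabilizing_iff {Ω : Type u} [MeasurableSpace Ω]
    {P : Measure Ω} {ω : ℕ → Ω → Fin N} {x₀ : Ω → Fin d → ℝ}
    (H : S.IsRegular P ω x₀ ρ) : MeanSquareStabilizing.{u} S K ↔ S.IsStable K :=
  ⟨fun h => H.isStable_of_tendsto (by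
    have := H.isProbabilityMeasure
    exact h Ω P ω ρ x₀ H.chain H.initial), fun h => h.meanSquareStabilizing⟩

/-! ### Cost and state correlation of a stable gain -/

namespace IsRegular

variable (H : S.IsRegular P ω x₀ ρ)
include H

theorem sum_pairing_modeMoment (K : Gains N d k) (Y : Fin N → Matrix (Fin d) (Fin d) ℝ) (t : ℕ) :
    ∑ s ∈ Finset.range t, pairing (Y - S.dualStep K Y) (fun i => S.modeMoment P ω x₀ K i s)
      = pairing Y (initialMoment P x₀ ρ) - pairing Y (fun i => S.modeMoment P ω x₀ K i t) := by
  have := H.isProbabilityMeasure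
  have h : ∀ s, pairing (Y - S.dualStep K Y) (fun i => S.modeMoment P ω x₀ K i s)
      = pairing Y (fun i => S.modeMoment P ω x₀ K i s)
        - pairing Y (fun i => S.modeMoment P ω x₀ K i (s + 1)) := by
    intro s
    rw [pairing_sub_left, S.pairing_modeMoment_succ H.chain H.initial]
  simp_rw [h]
  rw [Finset.sum_range_sub', H.modeMoment_zero_eq]

theorem tendsto_sum_pairing (hK : S.IsStable K) (Y : Fin N → Matrix (Fin d) (Fin d) ℝ) :
    Tendsto (fun t => ∑ s ∈ Finset.range t,
      pairing (Y - S.dualStep K Y) (fun i => S.modeMoment P ω x₀ K i s)) atTop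
      (𝓝 (pairing Y (initialMoment P x₀ ρ))) := by
  simp_rw [H.sum_pairing_modeMoment, H.pairing_modeMoment]
  have h2 := ((continuous_pairing_left (initialMoment P x₀ ρ)).tendsto 0).comp (hK Y)
  have h3 : pairing 0 (initialMoment P x₀ ρ) = 0 := by simp [pairing]
  rw [h3] at h2
  simpa using h2.const_sub (pairing Y (initialMoment P x₀ ρ))

theorem pairing_stageWeight_nonneg (t : ℕ) :
    0 ≤ pairing (S.stageWeight K) (fun i => S.modeMoment P ω x₀ K i t) :=
  pairing_nonneg (fun i => (posDef_stageWeight H.posDef_Q H.posDef_R K i).posSemidef)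
    fun i => H.posSemidef_modeMoment i t

theorem hasSum_pairing_stageWeight (hK : S.IsStable K) :
    HasSum (fun t => pairing (S.stageWeight K) (fun i => S.modeMoment P ω x₀ K i t))
      (pairing (S.lyapunov K) (initialMoment P x₀ ρ)) := by
  rw [hasSum_iff_tendsto_nat_of_nonneg fun t => H.pairing_stageWeight_nonneg t]
  have := H.tendsto_sum_pairing hK (S.lyapunov K)
  rwa [hK.sub_dualStep_lyapunov] at this

theorem posSemidef_lyapunov (hK : S.IsStable K) (i : Fin N) : (S.lyapunov K i).PosSemidef :=
  hK.posSemidef_lyapunov H.p_nonneg H.posDef_Q H.posDef_R i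

theorem pairing_lyapunov_nonneg (hK : S.IsStable K) :
    0 ≤ pairing (S.lyapunov K) (initialMoment P x₀ ρ) :=
  pairing_nonneg (H.posSemidef_lyapunov hK) fun i => (H.posDef_initialMoment i).posSemidef

theorem cost_eq (hK : S.IsStable K) :
    S.cost P ω x₀ K = ENNReal.ofReal (pairing (S.lyapunov K) (initialMoment P x₀ ρ)) := by
  have := H.isProbabilityMeasure
  rw [S.cost_eq_tsum H.chain H.initial H.posDef_Q H.posDef_R,
    ← (H.hasSum_pairing_stageWeight hK).tsum_eq,
    ENNReal.ofReal_tsum_of_nonneg (fun t => H.pairing_stageWeight_nonneg t)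
      (H.hasSum_pairing_stageWeight hK).summable]

theorem costReal_eq (hK : S.IsStable K) :
    S.costReal P ω x₀ K = pairing (S.lyapunov K) (initialMoment P x₀ ρ) := by
  rw [costReal, H.cost_eq hK, ENNReal.toReal_ofReal (H.pairing_lyapunov_nonneg hK)]

theorem summable_modeMoment (hK : S.IsStable K) (i : Fin N) :
    Summable (S.modeMoment P ω x₀ K i) := by
  refine Pi.summable.2 fun a => Pi.summable.2 fun b => ?_
  refine Summable.of_norm_bounded (((H.hasSum_pairing_stageWeight hK).summable).mul_left
    (sigmaMin (Matrix.blockDiagonal S.Q))⁻¹) fun t => ?_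
  have hX := fun i => H.posSemidef_modeMoment (K := K) i t
  rw [Real.norm_eq_abs]
  refine (abs_entry_le_trace (hX i) a b).trans ((trace_le_pairing_one hX i).trans ?_)
  rw [← div_eq_inv_mul, le_div_iff₀' H.sigmaMin_Q_pos, ← pairing_smul_left]
  exact pairing_le_left (fun i => H.posSemidef_stageWeight_sub K i) hX

theorem tendsto_sum_modeMoment (hK : S.IsStable K) :
    Tendsto (fun t => ∑ s ∈ Finset.range t, fun i => S.modeMoment P ω x₀ K i s) atTop
      (𝓝 (S.chiBlock P ω x₀ K)) := by
  refine tendsto_pi_nhds.2 fun i => ?_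
  simp only [Finset.sum_apply]
  exact (H.summable_modeMoment hK i).hasSum.tendsto_sum_nat

/-- The state correlation is dual to the Lyapunov operator. -/
theorem pairing_sub_dualStep_chiBlock (hK : S.IsStable K)
    (Y : Fin N → Matrix (Fin d) (Fin d) ℝ) :
    pairing (Y - S.dualStep K Y) (S.chiBlock P ω x₀ K) = pairing Y (initialMoment P x₀ ρ) := by
  refine tendsto_nhds_unique ?_ (H.tendsto_sum_pairing hK Y)
  simp_rw [← pairing_sum_right]
  exact ((continuous_pairing_right _).tendsto _).comp (H.tendsto_sum_modeMoment hK)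

theorem posSemidef_chiBlock_sub_initialMoment (hK : S.IsStable K) (i : Fin N) :
    (S.chiBlock P ω x₀ K i - initialMoment P x₀ ρ i).PosSemidef := by
  have h1 : Tendsto (fun t => (∑ s ∈ Finset.range (t + 1), S.modeMoment P ω x₀ K i s)
      - initialMoment P x₀ ρ i) atTop (𝓝 (S.chiBlock P ω x₀ K i - initialMoment P x₀ ρ i)) :=
    ((tendsto_add_atTop_iff_nat 1).2
      (H.summable_modeMoment hK i).hasSum.tendsto_sum_nat).sub_const _
  refine isClosed_posSemidef.mem_of_tendsto h1 (Eventually.of_forall fun t => ?_)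
  rw [Finset.sum_range_succ', ← H.modeMoment_zero_eq (K := K), add_sub_cancel_right]
  exact Matrix.posSemidef_sum _ fun s _ => H.posSemidef_modeMoment i (s + 1)

theorem posDef_chiBlock (hK : S.IsStable K) (i : Fin N) : (S.chiBlock P ω x₀ K i).PosDef := by
  have := (H.posDef_initialMoment i).add_posSemidef (H.posSemidef_chiBlock_sub_initialMoment hK i)
  rwa [add_sub_cancel] at this

theorem posSemidef_chiBlock_sub_mu (hK : S.IsStable K) (i : Fin N) :
    (S.chiBlock P ω x₀ K i - mu P ρ x₀ • (1 : Matrix (Fin d) (Fin d) ℝ)).PosSemidef := by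
  have := (H.posSemidef_initialMoment_sub_mu i).add (H.posSemidef_chiBlock_sub_initialMoment hK i)
  rwa [add_comm, sub_add_sub_cancel] at this

theorem costReal_eq_pairing_chiBlock (hK : S.IsStable K) :
    S.costReal P ω x₀ K = pairing (S.stageWeight K) (S.chiBlock P ω x₀ K) := by
  rw [H.costReal_eq hK, ← H.pairing_sub_dualStep_chiBlock hK, hK.sub_dualStep_lyapunov]

/-- The exact cost difference between two stable gains. -/
theorem costReal_sub_costReal (hK : S.IsStable K) (hK' : S.IsStable K') :
    S.costReal P ω x₀ K' - S.costReal P ω x₀ K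
      = pairing (S.valueChange (S.lyapunov K) K K') (S.chiBlock P ω x₀ K') := by
  rw [← hK.lyapunov_spec.valueChange_eq H.posDef_R
      (fun i => (H.posSemidef_lyapunov hK i).transpose_eq) K',
    H.costReal_eq_pairing_chiBlock hK', H.costReal_eq hK,
    ← H.pairing_sub_dualStep_chiBlock hK', ← pairing_sub_left]
  congr 1
  abel

end IsRegular

end JumpSystem

/-! ### Gains as Euclidean vectors -/

theorem continuous_absSum {n m : Type*} [Fintype n] [Fintype m] :
    Continuous (absSum : Matrix n m ℝ → ℝ) := by
  unfold absSum
  fun_prop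

theorem trace_transpose_mul_eq_sum {n m : Type*} [Fintype n] [Fintype m] (A B : Matrix n m ℝ) :
    (Aᵀ * B).trace = ∑ a, ∑ b, B a b * A a b := by
  simp only [Matrix.trace, Matrix.diag, Matrix.mul_apply, Matrix.transpose_apply]
  rw [Finset.sum_comm]
  exact Finset.sum_congr rfl fun a _ => Finset.sum_congr rfl fun b _ => mul_comm _ _

section Vectors

variable {N d k : ℕ}

theorem ofVec_toVec (K : Gains N d k) : ofVec (toVec K) = K := rfl

theorem continuous_ofVec :
    Continuous (ofVec : EuclideanSpace ℝ (Fin N × Fin k × Fin d) → Gains N d k) := by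
  refine continuous_pi fun i => continuous_matrix fun a b => ?_
  simp only [ofVec, Matrix.of_apply]
  fun_prop

theorem continuous_toVec :
    Continuous (toVec : Gains N d k → EuclideanSpace ℝ (Fin N × Fin k × Fin d)) := by
  refine (PiLp.continuous_toLp 2 _).comp (continuous_pi fun e => ?_)
  exact (continuous_apply_apply (e.2.1) (e.2.2)).comp (continuous_apply e.1)

theorem inner_toVec (K K' : Gains N d k) :
    inner ℝ (toVec K) (toVec K') = ∑ i, ((K' i)ᵀ * K i).trace := by
  simp only [trace_transpose_mul_eq_sum]
  rw [EuclideanSpace.inner_eq_star_dotProduct]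
  simp only [toVec, dotProduct, Fintype.sum_prod_type, star_trivial]
  exact Finset.sum_congr rfl fun i _ => Finset.sum_congr rfl fun a _ =>
    Finset.sum_congr rfl fun b _ => mul_comm _ _

end Vectors

namespace JumpSystem

variable {N d k : ℕ} {Ω : Type*} [MeasurableSpace Ω] {S : JumpSystem N d k}
  {P : Measure Ω} {ω : ℕ → Ω → Fin N} {x₀ : Ω → Fin d → ℝ} {ρ : Fin N → ℝ}
  {K K' : Gains N d k}

/-! ### Continuity in the gain -/

theorem continuous_valueChange (Y : Fin N → Matrix (Fin d) (Fin d) ℝ) (K : Gains N d k)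
    (i : Fin N) : Continuous fun K' => S.valueChange Y K K' i := by
  unfold valueChange
  fun_prop

theorem valueChange_self (Y : Fin N → Matrix (Fin d) (Fin d) ℝ) (K : Gains N d k)
    (i : Fin N) : S.valueChange Y K K i = 0 := by
  simp [valueChange]

theorem continuous_dualStep (Z : Fin N → Matrix (Fin d) (Fin d) ℝ) :
    Continuous fun K => S.dualStep K Z := by
  simp only [dualStep, closedLoop, LinearMap.coe_mk, AddHom.coe_mk]
  fun_prop

theorem valueChange_transpose (hR : ∀ i, (S.R i).PosDef) {Y : Fin N → Matrix (Fin d) (Fin d) ℝ}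
    (hY : ∀ i, (Y i)ᵀ = Y i) (i : Fin N) :
    (S.valueChange Y K K' i)ᵀ = S.valueChange Y K K' i := by
  simp only [valueChange, Matrix.transpose_add, Matrix.transpose_mul, Matrix.transpose_transpose,
    weightOf_transpose hR hY, Matrix.mul_assoc]
  abel

theorem tendsto_firstOrder (L : Gains N d k) (M : Fin N → Matrix (Fin k) (Fin k) ℝ)
    {X : Gains N d k → Fin N → Matrix (Fin d) (Fin d) ℝ} (hX : Tendsto X (𝓝 K) (𝓝 (X K))) :
    Tendsto (fun K' i => (2 : ℝ) • (L i * X K' i) + M i * (K' i - K i) * X K' i) (𝓝 K)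
      (𝓝 fun i => (2 : ℝ) • (L i * X K i)) := by
  have hc : Continuous fun q : Gains N d k × (Fin N → Matrix (Fin d) (Fin d) ℝ) => fun i =>
      (2 : ℝ) • (L i * q.2 i) + M i * (q.1 i - K i) * q.2 i := by
    fun_prop
  have h := (hc.tendsto (K, X K)).comp (tendsto_id.prodMk_nhds hX)
  simpa [Function.comp_def] using h

namespace IsRegular

variable (H : S.IsRegular P ω x₀ ρ)
include H

/-! ### Stability is an open condition -/

theorem lyapunov_transpose (hK : S.IsStable K) (i : Fin N) :
    (S.lyapunov K i)ᵀ = S.lyapunov K i :=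
  (H.posSemidef_lyapunov hK i).transpose_eq

theorem lyapunov_sub_dualStep (hK : S.IsStable K) (K' : Gains N d k) :
    S.lyapunov K - S.dualStep K' (S.lyapunov K)
      = S.stageWeight K' - S.valueChange (S.lyapunov K) K K' := by
  rw [← hK.lyapunov_spec.valueChange_eq H.posDef_R (H.lyapunov_transpose hK) K']
  abel

/-- The value matrices of a stable gain certify the stability of all nearby gains. -/
theorem eventually_posSemidef (hK : S.IsStable K) :
    ∀ᶠ K' in 𝓝 K, ∀ i, (S.lyapunov K i - S.dualStep K' (S.lyapunov K) i
      - (sigmaMin (Matrix.blockDiagonal S.Q) / 2) • (1 : Matrix (Fin d) (Fin d) ℝ)).PosSemidef := by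
  rw [eventually_all]
  intro i
  set q := sigmaMin (Matrix.blockDiagonal S.Q) with hq
  have hq0 : 0 < q := H.sigmaMin_Q_pos
  have h1 : Tendsto (fun K' => 2 * absSum (S.valueChange (S.lyapunov K) K K' i)) (𝓝 K) (𝓝 0) := by
    have h2 : Continuous fun K' => 2 * absSum (S.valueChange (S.lyapunov K) K K' i) :=
      continuous_const.mul (continuous_absSum.comp (continuous_valueChange _ K i))
    have h3 := h2.tendsto K
    rwa [valueChange_self, show 2 * absSum (0 : Matrix (Fin d) (Fin d) ℝ) = 0 by
      simp [absSum]] at h3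
  filter_upwards [h1.eventually_le_const (half_pos hq0)] with K' hK'
  have h4 := posSemidef_smul_one_sub_of_absSum_le
    (valueChange_transpose H.posDef_R (H.lyapunov_transpose hK) i) hK'
  convert! h4.add (H.posSemidef_stageWeight_sub K' i) using 1
  have h5 := congrFun (H.lyapunov_sub_dualStep hK K') i
  simp only [Pi.sub_apply] at h5
  rw [h5, ← hq]
  have h6 : q • (1 : Matrix (Fin d) (Fin d) ℝ) = (q / 2) • (1 : Matrix (Fin d) (Fin d) ℝ)
      + (q / 2) • (1 : Matrix (Fin d) (Fin d) ℝ) := by rw [← add_smul, add_halves]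
  rw [h6]
  abel

theorem eventually_isStable (hK : S.IsStable K) : ∀ᶠ K' in 𝓝 K, S.IsStable K' := by
  filter_upwards [H.eventually_posSemidef hK] with K' hK'
  exact isStable_of_lyapunov_inequality H.p_nonneg (H.posSemidef_lyapunov hK)
    (half_pos H.sigmaMin_Q_pos) hK'

/-! ### Continuity of the state correlation -/

theorem posSemidef_chiBlock (hK : S.IsStable K) (i : Fin N) :
    (S.chiBlock P ω x₀ K i).PosSemidef := (H.posDef_chiBlock hK i).posSemidef

/-- The certificate `Y - dualStep K' Y ≥ q / 2` with `Y = P^K` bounds `tr χ_{K'}` by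
`2 ⟨Y, X(0)⟩ / q`. -/
theorem eventually_abs_chiBlock_le (hK : S.IsStable K) :
    ∃ c, ∀ᶠ K' in 𝓝 K, ∀ i a b, |S.chiBlock P ω x₀ K' i a b| ≤ c := by
  refine ⟨pairing (S.lyapunov K) (initialMoment P x₀ ρ) /
    (sigmaMin (Matrix.blockDiagonal S.Q) / 2), ?_⟩
  filter_upwards [H.eventually_posSemidef hK, H.eventually_isStable hK] with K' h1 h2 i a b
  have hX := H.posSemidef_chiBlock h2
  refine (abs_entry_le_trace (hX i) a b).trans ((trace_le_pairing_one hX i).trans ?_)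
  rw [le_div_iff₀' (half_pos H.sigmaMin_Q_pos), ← pairing_smul_left,
    ← H.pairing_sub_dualStep_chiBlock h2]
  exact pairing_le_left h1 hX

/-- For `V = Z - dualStep K Z`, duality turns `⟨V, χ_{K'} - χ_K⟩` into
`⟨dualStep K' Z - dualStep K Z, χ_{K'}⟩`, which is small since `χ_{K'}` is bounded near `K`. -/
theorem tendsto_pairing_chiBlock (hK : S.IsStable K) (V : Fin N → Matrix (Fin d) (Fin d) ℝ) :
    Tendsto (fun K' => pairing V (S.chiBlock P ω x₀ K')) (𝓝 K)
      (𝓝 (pairing V (S.chiBlock P ω x₀ K))) := by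
  obtain ⟨Z, rfl⟩ := hK.exists_sub_dualStep_eq V
  obtain ⟨c, hc⟩ := H.eventually_abs_chiBlock_le hK
  rw [tendsto_iff_norm_sub_tendsto_zero]
  have hlim : Tendsto (fun K' => ∑ i, absSum (S.dualStep K' Z i - S.dualStep K Z i) * c) (𝓝 K)
      (𝓝 0) := by
    have h1 : Continuous fun K' => ∑ i, absSum (S.dualStep K' Z i - S.dualStep K Z i) * c :=
      continuous_finsetSum _ fun i _ => (continuous_absSum.comp
        (((continuous_apply i).comp (continuous_dualStep Z)).sub continuous_const)).mul
          continuous_const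
    have h2 := h1.tendsto K
    simpa [absSum] using h2
  refine squeeze_zero' (Eventually.of_forall fun _ => norm_nonneg _) ?_ hlim
  filter_upwards [hc, H.eventually_isStable hK] with K' h1 h2
  have h3 : pairing (Z - S.dualStep K Z) (S.chiBlock P ω x₀ K')
      - pairing (Z - S.dualStep K Z) (S.chiBlock P ω x₀ K)
      = pairing (S.dualStep K' Z - S.dualStep K Z) (S.chiBlock P ω x₀ K') := by
    rw [H.pairing_sub_dualStep_chiBlock hK, ← H.pairing_sub_dualStep_chiBlock h2,
      ← pairing_sub_left]
    congr 1
    abel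
  rw [h3, Real.norm_eq_abs]
  refine (Finset.abs_sum_le_sum_abs _ _).trans (Finset.sum_le_sum fun i _ => ?_)
  exact abs_trace_mul_le _ _ (h1 i)

theorem tendsto_chiBlock (hK : S.IsStable K) :
    Tendsto (fun K' => S.chiBlock P ω x₀ K') (𝓝 K) (𝓝 (S.chiBlock P ω x₀ K)) := by
  refine tendsto_pi_nhds.2 fun i => tendsto_matrix fun a b => ?_
  have h : ∀ X : Fin N → Matrix (Fin d) (Fin d) ℝ,
      pairing (Pi.single i (Matrix.single b a 1)) X = X i a b := by
    intro X
    rw [pairing, Finset.sum_eq_single i]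
    · simp [Matrix.trace_single_mul]
    · intro j _ hj
      simp [Pi.single_eq_of_ne hj]
    · simp
  simpa only [h] using H.tendsto_pairing_chiBlock hK (Pi.single i (Matrix.single b a 1))

/-! ### The gradient of the cost -/

/-- The exact first-order form of the cost difference. -/
theorem costReal_sub_costReal_eq_inner (hK : S.IsStable K) (hK' : S.IsStable K') :
    S.costReal P ω x₀ K' - S.costReal P ω x₀ K = inner ℝ
      (toVec fun i => (2 : ℝ) • (S.gradFactor K i * S.chiBlock P ω x₀ K' i)
        + S.inputWeight K i * (K' i - K i) * S.chiBlock P ω x₀ K' i) (toVec (K' - K)) := by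
  rw [H.costReal_sub_costReal hK hK', inner_toVec, pairing]
  refine Finset.sum_congr rfl fun i _ => ?_
  have hX := (H.posSemidef_chiBlock hK' i).transpose_eq
  have hs : ((S.factorOf (S.lyapunov K) K i)ᵀ * (K' i - K i) * S.chiBlock P ω x₀ K' i).trace
      = ((K' i - K i)ᵀ * (S.factorOf (S.lyapunov K) K i * S.chiBlock P ω x₀ K' i)).trace := by
    rw [← Matrix.trace_transpose, Matrix.transpose_mul, Matrix.transpose_mul, hX,
      Matrix.transpose_transpose, Matrix.trace_mul_comm, Matrix.mul_assoc]
  have hL : S.gradFactor K i = S.factorOf (S.lyapunov K) K i := rfl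
  have hW : S.inputWeight K i = S.weightOf (S.lyapunov K) i := rfl
  rw [valueChange, Matrix.add_mul, Matrix.add_mul, Matrix.trace_add, Matrix.trace_add, hs, hL, hW,
    Pi.sub_apply, Matrix.mul_add, Matrix.trace_add, Matrix.mul_smul, Matrix.trace_smul]
  simp only [Matrix.mul_assoc, smul_eq_mul]
  ring

/-- `∇C(K) = 2 L χ_K`. -/
theorem hasGradientAt_costOfVec (hK : S.IsStable K) :
    HasGradientAt (S.costOfVec P ω x₀)
      (toVec fun i => (2 : ℝ) • (S.gradFactor K i * S.chiBlock P ω x₀ K i)) (toVec K) := by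
  rw [hasGradientAt_iff_isLittleO]
  set G : Gains N d k → Gains N d k := fun K' i =>
    (2 : ℝ) • (S.gradFactor K i * S.chiBlock P ω x₀ K' i)
      + S.inputWeight K i * (K' i - K i) * S.chiBlock P ω x₀ K' i with hG
  have hGK : G K = fun i => (2 : ℝ) • (S.gradFactor K i * S.chiBlock P ω x₀ K i) := by
    funext i
    simp [hG]
  rw [← hGK]
  have hvec : Tendsto (ofVec : _ → Gains N d k) (𝓝 (toVec K)) (𝓝 K) :=
    continuous_ofVec.tendsto (toVec K)
  have hGlim : Tendsto G (𝓝 K) (𝓝 (G K)) := by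
    rw [hGK]
    exact tendsto_firstOrder _ _ (H.tendsto_chiBlock hK)
  have hlim : Tendsto (fun v => toVec (G (ofVec v)) - toVec (G K)) (𝓝 (toVec K)) (𝓝 0) := by
    have := ((continuous_toVec.tendsto (G K)).comp (hGlim.comp hvec)).sub_const (toVec (G K))
    rwa [sub_self] at this
  rw [Asymptotics.isLittleO_iff]
  intro c hc
  filter_upwards [hvec.eventually (H.eventually_isStable hK),
    (tendsto_zero_iff_norm_tendsto_zero.1 hlim).eventually_le_const hc] with v hv hle
  have h1 : S.costOfVec P ω x₀ v - S.costOfVec P ω x₀ (toVec K)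
      = inner ℝ (toVec (G (ofVec v))) (v - toVec K) :=
    H.costReal_sub_costReal_eq_inner hK hv
  rw [h1, ← inner_sub_left]
  exact (norm_inner_le_norm _ _).trans (mul_le_mul_of_nonneg_right hle (norm_nonneg _))

theorem costGradient_mul_inv_chiBlock (hK : S.IsStable K) (i : Fin N) :
    S.costGradient P ω x₀ K i * (S.chiBlock P ω x₀ K i)⁻¹ = (2 : ℝ) • S.gradFactor K i := by
  rw [costGradient, (H.hasGradientAt_costOfVec hK).gradient, ofVec_toVec, Matrix.smul_mul,
    Matrix.mul_nonsing_inv_cancel_right]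
  exact (Matrix.isUnit_iff_isUnit_det _).1 (H.posDef_chiBlock hK i).isUnit

end IsRegular

end JumpSystem

/-! ### Further semidefinite inequalities -/

theorem posSemidef_trace_smul_one_sub {n : Type*} [Fintype n] [DecidableEq n]
    {X : Matrix n n ℝ} (hX : X.PosSemidef) :
    (X.trace • (1 : Matrix n n ℝ) - X).PosSemidef := by
  refine posSemidef_of_transpose_eq (by simp [hX.transpose_eq]) fun v => ?_
  have hC : ((v ⬝ᵥ v) • (1 : Matrix n n ℝ) - Matrix.vecMulVec v v).PosSemidef := by
    refine posSemidef_of_transpose_eq (by simp [Matrix.transpose_vecMulVec]) fun u => ?_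
    have h : (u ⬝ᵥ v) ^ 2 ≤ (u ⬝ᵥ u) * (v ⬝ᵥ v) := by
      simpa [dotProduct, sq] using Finset.sum_mul_sq_le_sq_mul_sq Finset.univ u v
    rw [Matrix.sub_mulVec, dotProduct_sub, Matrix.smul_mulVec, Matrix.one_mulVec, dotProduct_smul,
      Matrix.vecMulVec_mulVec, op_smul_eq_smul, dotProduct_smul, smul_eq_mul, smul_eq_mul,
      dotProduct_comm v u]
    nlinarith
  have h := trace_mul_nonneg hC hX
  have h1 : v ⬝ᵥ (X *ᵥ v) = (Matrix.vecMulVec v v * X).trace := by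
    rw [Matrix.trace_mul_comm, Matrix.mul_vecMulVec, Matrix.trace_vecMulVec, dotProduct_comm]
  rw [Matrix.sub_mul, Matrix.trace_sub, ← h1, Matrix.smul_mul, Matrix.one_mul,
    Matrix.trace_smul, smul_eq_mul] at h
  rw [Matrix.sub_mulVec, dotProduct_sub, Matrix.smul_mulVec, Matrix.one_mulVec, dotProduct_smul,
    smul_eq_mul]
  linarith

theorem le_of_posSemidef_smul_one_sub {n : Type*} [Fintype n] [DecidableEq n] [Nonempty n]
    {M : Matrix n n ℝ} {a b : ℝ} (ha : (M - a • (1 : Matrix n n ℝ)).PosSemidef)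
    (hb : (b • (1 : Matrix n n ℝ) - M).PosSemidef) : a ≤ b := by
  obtain ⟨i⟩ := ‹Nonempty n›
  have h1 := ha.diag_nonneg (i := i)
  have h2 := hb.diag_nonneg (i := i)
  simp at h1 h2
  linarith

theorem mul_nonsing_inv_of_posDef {n : Type*} [Fintype n] [DecidableEq n] {M : Matrix n n ℝ}
    (hM : M.PosDef) : M * M⁻¹ = 1 :=
  Matrix.mul_nonsing_inv M ((Matrix.isUnit_iff_isUnit_det M).1 hM.isUnit)

theorem nonsing_inv_mul_of_posDef {n : Type*} [Fintype n] [DecidableEq n] {M : Matrix n n ℝ}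
    (hM : M.PosDef) : M⁻¹ * M = 1 :=
  Matrix.nonsing_inv_mul M ((Matrix.isUnit_iff_isUnit_det M).1 hM.isUnit)

/-- If `M ≥ c` then `c M⁻¹ ≤ 1`. -/
theorem posSemidef_one_sub_smul_inv {n : Type*} [Fintype n] [DecidableEq n] {M : Matrix n n ℝ}
    (hM : M.PosDef) {c : ℝ} (hc : 0 ≤ c) (h : (M - c • (1 : Matrix n n ℝ)).PosSemidef) :
    (1 - c • M⁻¹).PosSemidef := by
  have hT : (M⁻¹)ᵀ = M⁻¹ := hM.inv.posSemidef.transpose_eq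
  have h1 := (posSemidef_transpose_mul_self (1 - c • M⁻¹)).add
    ((h.transpose_mul_mul_same M⁻¹).smul_nonneg hc)
  convert! h1 using 1
  simp only [Matrix.transpose_sub, Matrix.transpose_one, Matrix.transpose_smul, hT,
    Matrix.sub_mul, Matrix.mul_sub, Matrix.one_mul, Matrix.mul_one, Matrix.smul_mul,
    Matrix.mul_smul, Matrix.mul_assoc, mul_nonsing_inv_of_posDef hM, smul_sub]
  abel

namespace JumpSystem

variable {N d k : ℕ} {Ω : Type*} [MeasurableSpace Ω] {S : JumpSystem N d k}
  {P : Measure Ω} {ω : ℕ → Ω → Fin N} {x₀ : Ω → Fin d → ℝ} {ρ : Fin N → ℝ}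
  {K K' Kopt : Gains N d k}

/-- The matrices `Lᵢᵀ Ψᵢ⁻¹ Lᵢ`, the largest possible decrease of the value matrices by a change
of the gain for a single step. -/
noncomputable def improvement (S : JumpSystem N d k) (K : Gains N d k) (i : Fin N) :
    Matrix (Fin d) (Fin d) ℝ :=
  (S.gradFactor K i)ᵀ * (S.inputWeight K i)⁻¹ * S.gradFactor K i

/-! ### Riccati equations and the optimal gain -/

theorem weightOf_mul_riccatiGain (hp : ∀ i j, 0 ≤ S.p i j) (hR : ∀ i, (S.R i).PosDef)
    {Y : Fin N → Matrix (Fin d) (Fin d) ℝ} (hY : ∀ i, (Y i).PosSemidef) (i : Fin N) :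
    S.weightOf Y i * S.riccatiGain Y i = (S.B i)ᵀ * S.nextMean Y i * S.A i := by
  have h := mul_nonsing_inv_of_posDef (posDef_weightOf hp hR hY i)
  have hg : S.riccatiGain Y i = (S.weightOf Y i)⁻¹ * ((S.B i)ᵀ * S.nextMean Y i * S.A i) := rfl
  rw [hg, ← Matrix.mul_assoc, h, Matrix.one_mul]

theorem factorOf_eq_zero_iff (hp : ∀ i j, 0 ≤ S.p i j) (hR : ∀ i, (S.R i).PosDef)
    {Y : Fin N → Matrix (Fin d) (Fin d) ℝ} (hY : ∀ i, (Y i).PosSemidef) :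
    S.factorOf Y K = 0 ↔ K = S.riccatiGain Y := by
  constructor
  · intro h
    funext i
    have h1 := congrFun h i
    rw [factorOf, Pi.zero_apply, sub_eq_zero] at h1
    change K i = (S.weightOf Y i)⁻¹ * _
    rw [← h1, ← Matrix.mul_assoc, nonsing_inv_mul_of_posDef (posDef_weightOf hp hR hY i),
      Matrix.one_mul]
  · rintro rfl
    funext i
    rw [factorOf, weightOf_mul_riccatiGain hp hR hY, sub_self, Pi.zero_apply]

/-- The Riccati equations are the Lyapunov equations of the gain that they define. -/
theorem isRiccatiSolution_iff (hp : ∀ i j, 0 ≤ S.p i j) (hR : ∀ i, (S.R i).PosDef)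
    {Y : Fin N → Matrix (Fin d) (Fin d) ℝ} (hY : ∀ i, (Y i).PosSemidef) :
    S.IsRiccatiSolution Y ↔ S.IsLyapunovSolution (S.riccatiGain Y) Y := by
  have hYs : ∀ i, (Y i)ᵀ = Y i := fun i => (hY i).transpose_eq
  rw [isLyapunovSolution_iff, funext_iff]
  refine forall_congr' fun i => ?_
  have h := stageWeight_add_dualStep_sub (S := S) hR hYs 0 (S.riccatiGain Y) i
  have h0 : S.stageWeight 0 i + S.dualStep 0 Y i
      = S.Q i + (S.A i)ᵀ * S.nextMean Y i * S.A i := by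
    simp [stageWeight, dualStep_apply, closedLoop]
  have hv : S.valueChange Y 0 (S.riccatiGain Y) i
      = -((S.A i)ᵀ * S.nextMean Y i * S.B i * (S.weightOf Y i)⁻¹
        * ((S.B i)ᵀ * S.nextMean Y i * S.A i)) := by
    have hm := weightOf_mul_riccatiGain hp hR hY i
    have hg : S.riccatiGain Y i = (S.weightOf Y i)⁻¹ * ((S.B i)ᵀ * S.nextMean Y i * S.A i) := rfl
    have hf : S.factorOf Y 0 i = -((S.B i)ᵀ * S.nextMean Y i * S.A i) := by simp [factorOf]
    have ht : ((S.B i)ᵀ * S.nextMean Y i * S.A i)ᵀ = (S.A i)ᵀ * S.nextMean Y i * S.B i := by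
      simp [Matrix.mul_assoc, S.nextMean_transpose Y hYs]
    rw [valueChange, hf, Pi.zero_apply, sub_zero, Matrix.mul_assoc _ (S.weightOf Y i), hm,
      Matrix.transpose_neg, ht, Matrix.mul_neg, Matrix.neg_mul]
    nth_rewrite 2 [hg]
    rw [Matrix.mul_assoc _ (S.weightOf Y i)⁻¹]
    abel
  have h1 : (S.stageWeight (S.riccatiGain Y) + S.dualStep (S.riccatiGain Y) Y) i
      = S.Q i + (S.A i)ᵀ * S.nextMean Y i * S.A i - (S.A i)ᵀ * S.nextMean Y i * S.B i
        * (S.weightOf Y i)⁻¹ * ((S.B i)ᵀ * S.nextMean Y i * S.A i) := by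
    rw [Pi.add_apply, eq_add_of_sub_eq h, hv, h0]
    abel
  rw [h1]
  rfl

namespace IsRegular

variable (H : S.IsRegular P ω x₀ ρ)
include H

theorem posDef_inputWeight (hK : S.IsStable K) (i : Fin N) : (S.inputWeight K i).PosDef :=
  posDef_weightOf H.p_nonneg H.posDef_R (H.posSemidef_lyapunov hK) i

theorem posSemidef_improvement (hK : S.IsStable K) (i : Fin N) :
    (S.improvement K i).PosSemidef :=
  (H.posDef_inputWeight hK i).inv.posSemidef.transpose_mul_mul_same _

theorem isStable_of_isLyapunovSolution {Y : Fin N → Matrix (Fin d) (Fin d) ℝ}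
    (hY : ∀ i, (Y i).PosSemidef) (h : S.IsLyapunovSolution K Y) : S.IsStable K := by
  refine isStable_of_lyapunov_inequality H.p_nonneg hY H.sigmaMin_Q_pos fun i => ?_
  have h1 : Y i - S.dualStep K Y i = S.stageWeight K i :=
    sub_eq_of_eq_add (congrFun (S.isLyapunovSolution_iff.1 h) i)
  rw [h1]
  exact H.posSemidef_stageWeight_sub K i

/-! ### Descent along a step -/

/-- A change of the gain that does not increase the one-step value preserves stability. -/
theorem isStable_of_valueChange (hK : S.IsStable K)
    (h : ∀ i, (-S.valueChange (S.lyapunov K) K K' i).PosSemidef) : S.IsStable K' := by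
  refine isStable_of_lyapunov_inequality H.p_nonneg (H.posSemidef_lyapunov hK)
    H.sigmaMin_Q_pos fun i => ?_
  convert! (H.posSemidef_stageWeight_sub K' i).add (h i) using 1
  have h1 := congrFun (H.lyapunov_sub_dualStep hK K') i
  simp only [Pi.sub_apply] at h1
  rw [h1]
  abel

theorem isStable_of_sufficient_decrease (hK : S.IsStable K) {c : ℝ} (hc : 0 ≤ c)
    (h : ∀ i, (-(c • S.improvement K i) - S.valueChange (S.lyapunov K) K K' i).PosSemidef) :
    S.IsStable K' := by
  refine H.isStable_of_valueChange hK fun i => ?_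
  convert! (h i).add ((H.posSemidef_improvement hK i).smul_nonneg hc) using 1
  abel

theorem costReal_sub_le_of_sufficient_decrease (hK : S.IsStable K) {c : ℝ} (hc : 0 ≤ c)
    (h : ∀ i, (-(c • S.improvement K i) - S.valueChange (S.lyapunov K) K K' i).PosSemidef) :
    S.costReal P ω x₀ K' - S.costReal P ω x₀ K
      ≤ -(c * (mu P ρ x₀ * pairing (S.improvement K) 1)) := by
  have hK' := H.isStable_of_sufficient_decrease hK hc h
  rw [H.costReal_sub_costReal hK hK']
  have h1 : pairing (S.valueChange (S.lyapunov K) K K') (S.chiBlock P ω x₀ K')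
      ≤ pairing ((-c) • S.improvement K) (S.chiBlock P ω x₀ K') :=
    pairing_le_left (fun i => by simpa using h i) (H.posSemidef_chiBlock hK')
  have h2 : pairing (S.improvement K) (mu P ρ x₀ • 1)
      ≤ pairing (S.improvement K) (S.chiBlock P ω x₀ K') :=
    pairing_le_right (H.posSemidef_chiBlock_sub_mu hK') (H.posSemidef_improvement hK)
  rw [pairing_smul_right] at h2
  rw [pairing_smul_left] at h1
  nlinarith

theorem posSemidef_specNorm_chi_sub (hK : S.IsStable K) (i : Fin N) :
    (specNorm (S.chi P ω x₀ K) • (1 : Matrix (Fin d) (Fin d) ℝ)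
      - S.chiBlock P ω x₀ K i).PosSemidef :=
  posSemidef_specNorm_sub_block (fun i => (H.posSemidef_chiBlock hK i).transpose_eq) i

theorem mu_le_specNorm_chi (hK : S.IsStable K) :
    mu P ρ x₀ ≤ specNorm (S.chi P ω x₀ K) := by
  have := H.state_nonempty
  obtain ⟨i⟩ := H.modes_nonempty
  exact le_of_posSemidef_smul_one_sub (H.posSemidef_chiBlock_sub_mu hK i)
    (H.posSemidef_specNorm_chi_sub hK i)

/-- Completing the square: no change of the gain decreases the value by more than
`improvement`. -/
theorem posSemidef_valueChange_add_improvement (hK : S.IsStable K) (K' : Gains N d k)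
    (i : Fin N) :
    (S.valueChange (S.lyapunov K) K K' i + S.improvement K i).PosSemidef := by
  have hW := H.posDef_inputWeight hK i
  have hT : ((S.inputWeight K i)⁻¹)ᵀ = (S.inputWeight K i)⁻¹ := hW.inv.posSemidef.transpose_eq
  convert! hW.posSemidef.transpose_mul_mul_same
    ((K' i - K i) + (S.inputWeight K i)⁻¹ * S.gradFactor K i) using 1
  have e1 : S.factorOf (S.lyapunov K) K i = S.gradFactor K i := rfl
  have e2 : S.weightOf (S.lyapunov K) i = S.inputWeight K i := rfl
  have e3 : ∀ M : Matrix (Fin k) (Fin d) ℝ,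
      S.inputWeight K i * ((S.inputWeight K i)⁻¹ * M) = M := fun M => by
    rw [← Matrix.mul_assoc, mul_nonsing_inv_of_posDef hW, Matrix.one_mul]
  have e4 : ∀ M : Matrix (Fin k) (Fin d) ℝ,
      (S.inputWeight K i)⁻¹ * (S.inputWeight K i * M) = M := fun M => by
    rw [← Matrix.mul_assoc, nonsing_inv_mul_of_posDef hW, Matrix.one_mul]
  rw [valueChange, improvement, e1, e2]
  generalize K' i - K i = D
  simp only [Matrix.transpose_add, Matrix.transpose_mul, hT, Matrix.add_mul, Matrix.mul_add,
    Matrix.mul_assoc, e3, e4]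
  abel

/-- Gradient domination. -/
theorem costReal_sub_le_improvement (hK : S.IsStable K) (hK' : S.IsStable K') :
    S.costReal P ω x₀ K - S.costReal P ω x₀ K'
      ≤ specNorm (S.chi P ω x₀ K') * pairing (S.improvement K) 1 := by
  have h1 := pairing_nonneg (H.posSemidef_valueChange_add_improvement hK K')
    (H.posSemidef_chiBlock hK')
  have h2 := pairing_add_left (S.valueChange (S.lyapunov K) K K') (S.improvement K)
    (S.chiBlock P ω x₀ K')
  have h3 := H.costReal_sub_costReal hK hK'
  have h4 : pairing (S.improvement K) (S.chiBlock P ω x₀ K')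
      ≤ pairing (S.improvement K) (specNorm (S.chi P ω x₀ K') • 1) :=
    pairing_le_right (H.posSemidef_specNorm_chi_sub hK') (H.posSemidef_improvement hK)
  rw [pairing_smul_right] at h4
  have h5 : pairing (fun i => S.valueChange (S.lyapunov K) K K' i + S.improvement K i)
      (S.chiBlock P ω x₀ K') = pairing (S.valueChange (S.lyapunov K) K K' + S.improvement K)
      (S.chiBlock P ω x₀ K') := rfl
  linarith

/-- Quadratic growth of the cost at a critical gain. -/
theorem norm_sq_le_costReal_sub (hopt : S.IsStable Kopt) (hcrit : S.gradFactor Kopt = 0)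
    (hK : S.IsStable K) :
    mu P ρ x₀ * (sigmaMin (Matrix.blockDiagonal S.R) * ‖toVec (K - Kopt)‖ ^ 2)
      ≤ S.costReal P ω x₀ K - S.costReal P ω x₀ Kopt := by
  rw [H.costReal_sub_costReal hopt hK]
  set r := sigmaMin (Matrix.blockDiagonal S.R) with hr
  set D : Fin N → Matrix (Fin d) (Fin d) ℝ := fun i => (K i - Kopt i)ᵀ * (K i - Kopt i) with hD
  have hD0 : ∀ i, (D i).PosSemidef := fun i => posSemidef_transpose_mul_self _
  have hr0 : 0 ≤ r := H.sigmaMin_R_pos.le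
  have h1 : pairing (r • D) (mu P ρ x₀ • 1) ≤ pairing (r • D) (S.chiBlock P ω x₀ K) :=
    pairing_le_right (H.posSemidef_chiBlock_sub_mu hK) fun i => (hD0 i).smul_nonneg hr0
  have h2 : pairing (r • D) (S.chiBlock P ω x₀ K)
      ≤ pairing (S.valueChange (S.lyapunov Kopt) Kopt K) (S.chiBlock P ω x₀ K) := by
    refine pairing_le_left (fun i => ?_) (H.posSemidef_chiBlock hK)
    have hf : S.factorOf (S.lyapunov Kopt) Kopt i = 0 := congrFun hcrit i
    have hle : (S.weightOf (S.lyapunov Kopt) i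
        - r • (1 : Matrix (Fin k) (Fin k) ℝ)).PosSemidef := by
      convert! (posSemidef_block_sub_sigmaMin H.posDef_R i).add
        ((posSemidef_nextMean H.p_nonneg (H.posSemidef_lyapunov hopt) i).transpose_mul_mul_same
          (S.B i)) using 1
      rw [weightOf]
      abel
    convert! hle.transpose_mul_mul_same (K i - Kopt i) using 1
    simp only [valueChange, hf, hD, Pi.smul_apply]
    generalize K i - Kopt i = E
    simp [Matrix.mul_sub, Matrix.sub_mul]
  have h3 : pairing D 1 = ‖toVec (K - Kopt)‖ ^ 2 := by
    rw [← real_inner_self_eq_norm_sq, inner_toVec, pairing_one_right]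
    rfl
  rw [pairing_smul_left, pairing_smul_right, h3] at h1
  linarith

theorem costReal_lt_of_ne (hopt : S.IsStable Kopt) (hcrit : S.gradFactor Kopt = 0)
    (hK : S.IsStable K) (hne : K ≠ Kopt) :
    S.costReal P ω x₀ Kopt < S.costReal P ω x₀ K := by
  have h := H.norm_sq_le_costReal_sub hopt hcrit hK
  have hpos : 0 < ‖toVec (K - Kopt)‖ := by
    rw [norm_pos_iff]
    intro h0
    refine hne (sub_eq_zero.1 ?_)
    have := congrArg ofVec h0
    rw [ofVec_toVec] at this
    rw [this]
    rfl
  have := mul_pos H.mu_pos (mul_pos H.sigmaMin_R_pos (pow_pos hpos 2))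
  linarith

theorem costReal_le (hopt : S.IsStable Kopt) (hcrit : S.gradFactor Kopt = 0)
    (hK : S.IsStable K) : S.costReal P ω x₀ Kopt ≤ S.costReal P ω x₀ K := by
  by_cases h : K = Kopt
  · rw [h]
  · exact (H.costReal_lt_of_ne hopt hcrit hK h).le

/-- Linear convergence of any iteration whose steps achieve a fixed fraction `c` of the possible
improvement on the initial sublevel set. -/
theorem iterate_convergence (hopt : S.IsStable Kopt) (hcrit : S.gradFactor Kopt = 0)
    {K₀ : Gains N d k} (hK₀ : S.IsStable K₀) {c : ℝ} (hc : 0 < c) (hc1 : c ≤ 1)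
    (step : Gains N d k → Gains N d k)
    (hstep : ∀ K, S.IsStable K → S.costReal P ω x₀ K ≤ S.costReal P ω x₀ K₀ → ∀ i,
      (-(c • S.improvement K i) - S.valueChange (S.lyapunov K) K (step K) i).PosSemidef) :
    0 ≤ 1 - c * mu P ρ x₀ / specNorm (S.chi P ω x₀ Kopt) ∧
    1 - c * mu P ρ x₀ / specNorm (S.chi P ω x₀ Kopt) < 1 ∧
    Tendsto (fun n => step^[n] K₀) atTop (𝓝 Kopt) ∧
    ∀ n : ℕ, S.IsStable (step^[n] K₀) ∧
      S.costReal P ω x₀ (step^[n] K₀) - S.costReal P ω x₀ Kopt ≤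
        (1 - c * mu P ρ x₀ / specNorm (S.chi P ω x₀ Kopt)) ^ n *
          (S.costReal P ω x₀ K₀ - S.costReal P ω x₀ Kopt) := by
  have hmu := H.mu_pos
  have hle := H.mu_le_specNorm_chi hopt
  have hX : 0 < specNorm (S.chi P ω x₀ Kopt) := hmu.trans_le hle
  set X := specNorm (S.chi P ω x₀ Kopt) with hXdef
  set θ := 1 - c * mu P ρ x₀ / X with hθ
  have hθ0 : 0 ≤ θ := by
    rw [hθ, sub_nonneg, div_le_one hX]
    nlinarith
  have hθ1 : θ < 1 := by
    rw [hθ, sub_lt_self_iff]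
    positivity
  have hmain : ∀ n : ℕ, S.IsStable (step^[n] K₀) ∧
      S.costReal P ω x₀ (step^[n] K₀) - S.costReal P ω x₀ Kopt ≤
        θ ^ n * (S.costReal P ω x₀ K₀ - S.costReal P ω x₀ Kopt) := by
    have hgap : 0 ≤ S.costReal P ω x₀ K₀ - S.costReal P ω x₀ Kopt :=
      sub_nonneg.2 (H.costReal_le hopt hcrit hK₀)
    intro n
    induction n with
    | zero => exact ⟨hK₀, by simp⟩
    | succ n ih =>
      obtain ⟨hst, hcost⟩ := ih
      set Kn := step^[n] K₀ with hKn
      have hsub : S.costReal P ω x₀ Kn ≤ S.costReal P ω x₀ K₀ := by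
        have := mul_le_mul_of_nonneg_right (pow_le_one₀ (n := n) hθ0 hθ1.le) hgap
        linarith
      have hs := hstep Kn hst hsub
      rw [Function.iterate_succ_apply', ← hKn]
      refine ⟨H.isStable_of_sufficient_decrease hst hc.le hs, ?_⟩
      have h1 := H.costReal_sub_le_of_sufficient_decrease hst hc.le hs
      have h2 := H.costReal_sub_le_improvement hst hopt
      have h3 : c * mu P ρ x₀ / X * (S.costReal P ω x₀ Kn - S.costReal P ω x₀ Kopt)
          ≤ c * (mu P ρ x₀ * pairing (S.improvement Kn) 1) := by
        rw [div_mul_eq_mul_div, div_le_iff₀ hX]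
        have := mul_le_mul_of_nonneg_left h2 (mul_pos hc hmu).le
        linarith
      calc S.costReal P ω x₀ (step Kn) - S.costReal P ω x₀ Kopt
          ≤ θ * (S.costReal P ω x₀ Kn - S.costReal P ω x₀ Kopt) := by
            rw [hθ]
            linarith
        _ ≤ θ * (θ ^ n * (S.costReal P ω x₀ K₀ - S.costReal P ω x₀ Kopt)) :=
            mul_le_mul_of_nonneg_left hcost hθ0
        _ = _ := by ring
  refine ⟨hθ0, hθ1, ?_, hmain⟩
  have hlim : Tendsto (fun n : ℕ => (mu P ρ x₀ * sigmaMin (Matrix.blockDiagonal S.R))⁻¹ *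
      (θ ^ n * (S.costReal P ω x₀ K₀ - S.costReal P ω x₀ Kopt))) atTop (𝓝 0) := by
    simpa using ((tendsto_pow_atTop_nhds_zero_of_lt_one hθ0 hθ1).mul_const _).const_mul
      (mu P ρ x₀ * sigmaMin (Matrix.blockDiagonal S.R))⁻¹
  have hsq : Tendsto (fun n : ℕ => ‖toVec (step^[n] K₀ - Kopt)‖ ^ 2) atTop (𝓝 0) := by
    refine squeeze_zero (fun n => sq_nonneg _) (fun n => ?_) hlim
    rw [← div_eq_inv_mul, le_div_iff₀' (mul_pos hmu H.sigmaMin_R_pos), mul_assoc]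
    exact (H.norm_sq_le_costReal_sub hopt hcrit (hmain n).1).trans (hmain n).2
  have hnorm : Tendsto (fun n : ℕ => ‖toVec (step^[n] K₀) - toVec Kopt‖) atTop (𝓝 0) := by
    have h1 := (Real.continuous_sqrt.tendsto 0).comp hsq
    rw [Real.sqrt_zero] at h1
    refine h1.congr fun n => ?_
    simp only [Function.comp_apply, Real.sqrt_sq (norm_nonneg _)]
    rfl
  exact (continuous_ofVec.tendsto (toVec Kopt)).comp
    (tendsto_iff_norm_sub_tendsto_zero.2 hnorm)

/-! ### The two policy iterations -/

/-- The step changes the value by `-(4η - 4η²) Lᵀ Ψ⁻¹ L`, and `4η - 4η² ≥ 2η` for `η ≤ 1 / 2`. -/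
theorem gaussNewton_sufficient_decrease (hK : S.IsStable K) {η : ℝ} (hη : 0 ≤ η)
    (hη1 : η ≤ 1 / 2) (i : Fin N) :
    (-((2 * η) • S.improvement K i)
      - S.valueChange (S.lyapunov K) K (S.gaussNewtonStep η K) i).PosSemidef := by
  have hW := H.posDef_inputWeight hK i
  have hT : ((S.inputWeight K i)⁻¹)ᵀ = (S.inputWeight K i)⁻¹ := hW.inv.posSemidef.transpose_eq
  have e1 : S.factorOf (S.lyapunov K) K i = S.gradFactor K i := rfl
  have e2 : S.weightOf (S.lyapunov K) i = S.inputWeight K i := rfl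
  have e3 : ∀ M : Matrix (Fin k) (Fin d) ℝ,
      S.inputWeight K i * ((S.inputWeight K i)⁻¹ * M) = M := fun M => by
    rw [← Matrix.mul_assoc, mul_nonsing_inv_of_posDef hW, Matrix.one_mul]
  have h : (2 * η * (1 - 2 * η)) • S.improvement K i = -((2 * η) • S.improvement K i)
      - S.valueChange (S.lyapunov K) K (S.gaussNewtonStep η K) i := by
    rw [valueChange, gaussNewtonStep, sub_sub_cancel_left, e1, e2, improvement]
    simp only [Matrix.transpose_neg, Matrix.transpose_smul, Matrix.transpose_mul, hT,
      Matrix.neg_mul, Matrix.mul_neg, Matrix.smul_mul, Matrix.mul_smul, Matrix.mul_assoc, e3]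
    module
  rw [← h]
  exact (H.posSemidef_improvement hK i).smul_nonneg (by nlinarith)

theorem naturalGradientStep_eq (hK : S.IsStable K) (η : ℝ) :
    S.naturalGradientStep P ω x₀ η K = fun i => K i - (2 * η) • S.gradFactor K i := by
  funext i
  rw [naturalGradientStep, H.costGradient_mul_inv_chiBlock hK, smul_smul, mul_comm]

/-- `Ψᵢ ≤ ‖R̂‖ + ‖B̂‖² C(K) / μ`, since `C(K) ≥ μ ∑ⱼ tr Pⱼ`. -/
theorem posSemidef_sub_inputWeight (hK : S.IsStable K) {c : ℝ}
    (hc : S.costReal P ω x₀ K ≤ c) (i : Fin N) :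
    ((specNorm (Matrix.blockDiagonal S.R) + specNorm (Matrix.blockDiagonal S.B) ^ 2 * c
      / mu P ρ x₀) • (1 : Matrix (Fin k) (Fin k) ℝ) - S.inputWeight K i).PosSemidef := by
  have hY := H.posSemidef_lyapunov hK
  set e := pairing 1 (S.lyapunov K) with he
  have he0 : 0 ≤ e := pairing_nonneg (fun _ => Matrix.PosSemidef.one) hY
  have hec : e ≤ c / mu P ρ x₀ := by
    rw [le_div_iff₀' H.mu_pos]
    exact (H.mu_mul_pairing_one_le hY).trans ((H.costReal_eq hK).symm.le.trans hc)
  have hp1 : ∀ j, S.p i j ≤ 1 := fun j => by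
    rw [← H.p_sum i]
    exact Finset.single_le_sum (fun j _ => H.p_nonneg i j) (Finset.mem_univ j)
  have hE : (e • (1 : Matrix (Fin d) (Fin d) ℝ) - S.nextMean (S.lyapunov K) i).PosSemidef := by
    have h1 : e • (1 : Matrix (Fin d) (Fin d) ℝ) - S.nextMean (S.lyapunov K) i
        = ∑ j, (S.p i j • ((S.lyapunov K j).trace • (1 : Matrix (Fin d) (Fin d) ℝ)
            - S.lyapunov K j)
          + ((1 - S.p i j) * (S.lyapunov K j).trace) • (1 : Matrix (Fin d) (Fin d) ℝ)) := by
      rw [he, pairing_one_left, Finset.sum_smul, nextMean, ← Finset.sum_sub_distrib]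
      refine Finset.sum_congr rfl fun j _ => ?_
      module
    rw [h1]
    exact Matrix.posSemidef_sum _ fun j _ =>
      ((posSemidef_trace_smul_one_sub (hY j)).smul_nonneg (H.p_nonneg i j)).add
        (Matrix.PosSemidef.one.smul_nonneg
          (mul_nonneg (sub_nonneg.2 (hp1 j)) (hY j).trace_nonneg))
  set b := specNorm (Matrix.blockDiagonal S.B) with hb
  have h2 := ((posSemidef_specNorm_sub_block
    (fun i => (H.posDef_R i).posSemidef.transpose_eq) i).add
    ((posSemidef_specNorm_sq_sub_block S.B i).smul_nonneg he0)).add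
    ((hE.transpose_mul_mul_same (S.B i)).add
      (Matrix.PosSemidef.one.smul_nonneg (n := Fin k)
        (mul_nonneg (sq_nonneg b) (sub_nonneg.2 hec))))
  convert! h2 using 1
  rw [inputWeight, ← hb]
  simp only [Matrix.mul_sub, Matrix.sub_mul, Matrix.mul_smul, Matrix.smul_mul, Matrix.mul_one,
    mul_div_assoc]
  module

theorem sigmaMin_R_le_add (K₀ : Gains N d k) :
    sigmaMin (Matrix.blockDiagonal S.R) ≤ specNorm (Matrix.blockDiagonal S.R)
      + specNorm (Matrix.blockDiagonal S.B) ^ 2 * S.costReal P ω x₀ K₀ / mu P ρ x₀ := by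
  have := H.input_nonempty
  obtain ⟨i⟩ := H.modes_nonempty
  have h1 := le_of_posSemidef_smul_one_sub (posSemidef_block_sub_sigmaMin H.posDef_R i)
    (posSemidef_specNorm_sub_block (fun i => (H.posDef_R i).posSemidef.transpose_eq) i)
  have h2 : 0 ≤ specNorm (Matrix.blockDiagonal S.B) ^ 2 * S.costReal P ω x₀ K₀ / mu P ρ x₀ :=
    div_nonneg (mul_nonneg (sq_nonneg _) ENNReal.toReal_nonneg) H.mu_pos.le
  linarith

/-- The step is `Δ = -2η L`; it uses `r ≤ Ψ ≤ 1 / (2η)` with `r = σ_min(R̂)`. -/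
theorem naturalGradient_sufficient_decrease (hK : S.IsStable K) {η c : ℝ} (hη : 0 ≤ η)
    (hc : S.costReal P ω x₀ K ≤ c)
    (hη1 : 2 * η * (specNorm (Matrix.blockDiagonal S.R)
      + specNorm (Matrix.blockDiagonal S.B) ^ 2 * c / mu P ρ x₀) ≤ 1) (i : Fin N) :
    (-((2 * η * sigmaMin (Matrix.blockDiagonal S.R)) • S.improvement K i)
      - S.valueChange (S.lyapunov K) K (S.naturalGradientStep P ω x₀ η K) i).PosSemidef := by
  have hW := H.posDef_inputWeight hK i
  have hβ := H.posSemidef_sub_inputWeight hK hc i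
  set β := specNorm (Matrix.blockDiagonal S.R)
      + specNorm (Matrix.blockDiagonal S.B) ^ 2 * c / mu P ρ x₀ with hβdef
  set r := sigmaMin (Matrix.blockDiagonal S.R) with hr
  have hle : (S.inputWeight K i - r • (1 : Matrix (Fin k) (Fin k) ℝ)).PosSemidef := by
    convert! (posSemidef_block_sub_sigmaMin H.posDef_R i).add
      ((posSemidef_nextMean H.p_nonneg (H.posSemidef_lyapunov hK) i).transpose_mul_mul_same
        (S.B i)) using 1
    rw [inputWeight]
    abel
  have h1 : (1 - r • (S.inputWeight K i)⁻¹).PosSemidef :=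
    posSemidef_one_sub_smul_inv hW H.sigmaMin_R_pos.le hle
  have h2 : (1 - (2 * η) • S.inputWeight K i).PosSemidef := by
    convert! (Matrix.PosSemidef.one.smul_nonneg (n := Fin k) (sub_nonneg.2 hη1)).add
      (hβ.smul_nonneg (mul_nonneg zero_le_two hη)) using 1
    module
  have h2η : 0 ≤ 2 * η := mul_nonneg zero_le_two hη
  -- the difference is `2η Lᵀ (1 - r Ψ⁻¹) L + 2η Lᵀ (1 - 2η Ψ) L`
  convert! ((h1.transpose_mul_mul_same (S.gradFactor K i)).smul_nonneg h2η).add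
    ((h2.transpose_mul_mul_same (S.gradFactor K i)).smul_nonneg h2η) using 1
  have e1 : S.factorOf (S.lyapunov K) K i = S.gradFactor K i := rfl
  have e2 : S.weightOf (S.lyapunov K) i = S.inputWeight K i := rfl
  rw [H.naturalGradientStep_eq hK, valueChange, e1, e2, improvement]
  simp only [sub_sub_cancel_left, Matrix.transpose_neg, Matrix.transpose_smul, Matrix.neg_mul,
    Matrix.mul_neg, Matrix.smul_mul, Matrix.mul_smul, Matrix.mul_assoc, Matrix.mul_sub,
    Matrix.sub_mul, Matrix.one_mul]
  module

/-! ### Existence of the optimal gain -/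

/-- The cost is minimized by compactness of the set of gains and value matrices that satisfy the
Lyapunov equations with bounded cost; a minimizer is critical since otherwise a Gauss–Newton
step would decrease the cost. -/
theorem exists_critical {K₀ : Gains N d k} (hK₀ : S.IsStable K₀) :
    ∃ Kopt, S.IsStable Kopt ∧ S.gradFactor Kopt = 0 := by
  set c₀ := S.costReal P ω x₀ K₀ with hc₀
  set C : Set (Gains N d k × (Fin N → Matrix (Fin d) (Fin d) ℝ)) :=
    {q | (∀ i, (q.2 i).PosSemidef) ∧ q.2 = S.stageWeight q.1 + S.dualStep q.1 q.2 ∧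
      pairing q.2 (initialMoment P x₀ ρ) ≤ c₀} with hC
  have hmem : ∀ K, S.IsStable K → S.costReal P ω x₀ K ≤ c₀ → (K, S.lyapunov K) ∈ C :=
    fun K hK hle => ⟨H.posSemidef_lyapunov hK, S.isLyapunovSolution_iff.1 hK.lyapunov_spec,
      by rwa [← H.costReal_eq hK]⟩
  have hclosed : IsClosed C := by
    have h1 : IsClosed {q : Gains N d k × (Fin N → Matrix (Fin d) (Fin d) ℝ) |
        ∀ i, (q.2 i).PosSemidef} := by
      rw [Set.ofPred_forall]
      exact isClosed_iInter fun i => (isClosed_posSemidef (n := Fin d)).preimage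
        (f := fun q : Gains N d k × (Fin N → Matrix (Fin d) (Fin d) ℝ) => q.2 i) (by fun_prop)
    have h2 : IsClosed {q : Gains N d k × (Fin N → Matrix (Fin d) (Fin d) ℝ) |
        q.2 = S.stageWeight q.1 + S.dualStep q.1 q.2} := by
      refine isClosed_eq continuous_snd (continuous_pi fun i => ?_)
      simp only [Pi.add_apply, dualStep_apply, closedLoop, stageWeight, nextMean]
      fun_prop
    exact h1.inter (h2.inter (isClosed_le
      ((continuous_pairing_left _).comp continuous_snd) continuous_const))
  set b := c₀ / mu P ρ x₀ with hb
  set b' := b / sigmaMin (Matrix.blockDiagonal S.R) + 1 with hb'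
  -- `μ ∑ᵢ tr Yᵢ ≤ ⟨Y, X(0)⟩ ≤ c₀`
  have htr : ∀ q ∈ C, ∀ i, (q.2 i).trace ≤ b := by
    rintro q ⟨h1, -, h3⟩ i
    refine (trace_le_pairing_one h1 i).trans ?_
    rw [hb, le_div_iff₀' H.mu_pos]
    exact (H.mu_mul_pairing_one_le h1).trans h3
  -- `r Kᵢᵀ Kᵢ ≤ Yᵢ` for `r = σ_min(R̂)`, and `x² ≤ s` gives `|x| ≤ s + 1`
  have hgain : ∀ q ∈ C, ∀ i a e, |q.1 i a e| ≤ b' := by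
    intro q hq i a e
    have h1 : (q.2 i - sigmaMin (Matrix.blockDiagonal S.R) • ((q.1 i)ᵀ * q.1 i)).PosSemidef := by
      convert! ((H.posDef_Q i).posSemidef.add
        ((posSemidef_block_sub_sigmaMin H.posDef_R i).transpose_mul_mul_same (q.1 i))).add
        (posSemidef_dualStep H.p_nonneg q.1 hq.1 i) using 1
      have h2 := congrFun hq.2.1 i
      rw [h2]
      simp only [Pi.add_apply, stageWeight, Matrix.mul_sub, Matrix.sub_mul, Matrix.mul_smul,
        Matrix.smul_mul, Matrix.mul_one]
      abel
    have h3 := h1.trace_nonneg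
    rw [Matrix.trace_sub, Matrix.trace_smul, smul_eq_mul, trace_transpose_mul_eq_sum] at h3
    have h4 : q.1 i a e * q.1 i a e ≤ ∑ a, ∑ e, q.1 i a e * q.1 i a e :=
      (Finset.single_le_sum (f := fun e => q.1 i a e * q.1 i a e)
        (fun e _ => mul_self_nonneg _) (Finset.mem_univ e)).trans
      (Finset.single_le_sum (f := fun a => ∑ e, q.1 i a e * q.1 i a e)
        (fun a _ => Finset.sum_nonneg fun e _ => mul_self_nonneg _) (Finset.mem_univ a))
    have h5 : q.1 i a e * q.1 i a e ≤ b / sigmaMin (Matrix.blockDiagonal S.R) := by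
      rw [le_div_iff₀' H.sigmaMin_R_pos]
      have := mul_le_mul_of_nonneg_left h4 H.sigmaMin_R_pos.le
      have := htr q hq i
      linarith
    rw [hb', abs_le]
    constructor <;> nlinarith [sq_nonneg (q.1 i a e - 1), sq_nonneg (q.1 i a e + 1)]
  have hcompact : IsCompact C := by
    have hbox : IsCompact ((Set.univ.pi fun _ : Fin N => Set.univ.pi fun _ : Fin k =>
          Set.univ.pi fun _ : Fin d => Set.Icc (-b') b') ×ˢ
        (Set.univ.pi fun _ : Fin N => Set.univ.pi fun _ : Fin d =>
          Set.univ.pi fun _ : Fin d => Set.Icc (-b) b) :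
        Set ((Fin N → Fin k → Fin d → ℝ) × (Fin N → Fin d → Fin d → ℝ))) :=
      (isCompact_univ_pi fun _ => isCompact_univ_pi fun _ => isCompact_univ_pi fun _ =>
        isCompact_Icc).prod (isCompact_univ_pi fun _ => isCompact_univ_pi fun _ =>
          isCompact_univ_pi fun _ => isCompact_Icc)
    refine IsCompact.of_isClosed_subset hbox hclosed fun q hq => ⟨?_, ?_⟩
    · exact fun i _ a _ e _ => abs_le.1 (hgain q hq i a e)
    · exact fun i _ a _ e _ =>
        abs_le.1 ((abs_entry_le_trace (hq.1 i) a e).trans (htr q hq i))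
  obtain ⟨⟨Kopt, Y⟩, hq, hmin⟩ := hcompact.exists_isMinOn ⟨_, hmem K₀ hK₀ le_rfl⟩
    ((continuous_pairing_left (initialMoment P x₀ ρ)).comp continuous_snd).continuousOn
  have hlyap : S.IsLyapunovSolution Kopt Y := S.isLyapunovSolution_iff.2 hq.2.1
  have hopt : S.IsStable Kopt := H.isStable_of_isLyapunovSolution hq.1 hlyap
  have hY : S.lyapunov Kopt = Y := hopt.lyapunov_eq hlyap
  refine ⟨Kopt, hopt, ?_⟩
  -- with `η = 1 / 2` the Gauss–Newton step attains the full improvement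
  have hdec := H.gaussNewton_sufficient_decrease hopt (η := 1 / 2) (by norm_num) le_rfl
  have hst := H.isStable_of_sufficient_decrease hopt (by norm_num) hdec
  have hle := H.costReal_sub_le_of_sufficient_decrease hopt (by norm_num) hdec
  have hcost : S.costReal P ω x₀ Kopt = pairing Y (initialMoment P x₀ ρ) := by
    rw [H.costReal_eq hopt, hY]
  have himp0 : 0 ≤ pairing (S.improvement Kopt) 1 :=
    pairing_nonneg (H.posSemidef_improvement hopt) fun _ => Matrix.PosSemidef.one
  have hmu := H.mu_pos
  have hge : S.costReal P ω x₀ Kopt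
      ≤ S.costReal P ω x₀ (S.gaussNewtonStep (1 / 2) Kopt) := by
    have h1 : S.costReal P ω x₀ (S.gaussNewtonStep (1 / 2) Kopt) ≤ c₀ := by
      have h2 : pairing Y (initialMoment P x₀ ρ) ≤ c₀ := hq.2.2
      have := mul_nonneg hmu.le himp0
      linarith
    have h3 := isMinOn_iff.1 hmin _ (hmem _ hst h1)
    rw [hcost, H.costReal_eq hst]
    exact h3
  have himp : pairing (S.improvement Kopt) 1 = 0 := by
    have : mu P ρ x₀ * pairing (S.improvement Kopt) 1 ≤ 0 := by linarith
    exact le_antisymm (nonpos_of_mul_nonpos_right this hmu) himp0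
  funext i
  have htr0 : (S.improvement Kopt i).trace = 0 := by
    refine le_antisymm ?_ (H.posSemidef_improvement hopt i).trace_nonneg
    rw [← himp, pairing_one_right, ← pairing_one_left]
    exact trace_le_pairing_one (H.posSemidef_improvement hopt) i
  have hzero := (H.posSemidef_improvement hopt i).trace_eq_zero_iff.1 htr0
  have hinv := (H.posDef_inputWeight hopt i).inv
  refine Matrix.ext_of_mulVec_single fun e => ?_
  rw [Pi.zero_apply, Matrix.zero_mulVec]
  by_contra hne
  have hpos := hinv.dotProduct_mulVec_pos hne
  have h1 : (S.gradFactor Kopt i *ᵥ Pi.single e 1) ⬝ᵥ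
      ((S.inputWeight Kopt i)⁻¹ *ᵥ (S.gradFactor Kopt i *ᵥ Pi.single e 1))
      = Pi.single e 1 ⬝ᵥ (S.improvement Kopt i *ᵥ Pi.single e 1) := by
    rw [improvement, ← Matrix.mulVec_mulVec, ← Matrix.mulVec_mulVec,
      Matrix.dotProduct_mulVec (Pi.single e 1) (S.gradFactor Kopt i)ᵀ, Matrix.vecMul_transpose]
  rw [star_trivial, h1, hzero, Matrix.zero_mulVec, dotProduct_zero] at hpos
  exact lt_irrefl _ hpos

end IsRegular

end JumpSystem

end MJLS

theorem theorem1 {N d k : ℕ} (hd : 0 < d) (hk : 0 < k)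
    (S : MJLS.JumpSystem N d k)
    (hQ : ∀ i, (S.Q i).PosDef) (hR : ∀ i, (S.R i).PosDef)
    (hp_nonneg : ∀ i j, 0 ≤ S.p i j) (hp_sum : ∀ i, ∑ j, S.p i j = 1)
    (ρ : Fin N → ℝ) (hρ_pos : ∀ i, 0 < ρ i) (hρ_sum : ∑ i, ρ i = 1)
    {Ω : Type u} [MeasurableSpace Ω] (P : Measure Ω) [IsProbabilityMeasure P]
    (ω : ℕ → Ω → Fin N) (hω : MJLS.IsMarkovChain P ω ρ S.p)
    (x₀ : Ω → Fin d → ℝ) (hx₀ : MJLS.IsInitialState P ω x₀)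
    (hx₀_pos : (MJLS.secondMoment P x₀).PosDef)
    (K₀ : MJLS.Gains N d k)
    (hK₀ : MJLS.JumpSystem.MeanSquareStabilizing.{u} S K₀)
    (hK₀_cost : S.cost P ω x₀ K₀ ≠ ⊤) :
    -- every quantity used below is well defined on the set of stabilizing gains
    (∀ K, MJLS.JumpSystem.MeanSquareStabilizing.{u} S K →
      S.cost P ω x₀ K ≠ ⊤ ∧
      DifferentiableAt ℝ (S.costOfVec P ω x₀) (MJLS.toVec K) ∧
      (∃! Y, S.IsLyapunovSolution K Y) ∧
      (∀ i, Summable (S.modeMoment P ω x₀ K i)) ∧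
      (∀ i, (S.chiBlock P ω x₀ K i).PosDef)) ∧
    ∃ (Y : Fin N → Matrix (Fin d) (Fin d) ℝ) (Kstar : MJLS.Gains N d k),
      -- `Kstar` comes from the unique positive definite solution of the Riccati equations
      (∀ i, (Y i).PosDef) ∧ S.IsRiccatiSolution Y ∧
      (∀ Y' : Fin N → Matrix (Fin d) (Fin d) ℝ,
        (∀ i, (Y' i).PosDef) → S.IsRiccatiSolution Y' → Y' = Y) ∧
      Kstar = S.riccatiGain Y ∧
      -- and is the unique global minimum over the stabilizing gains
      MJLS.JumpSystem.MeanSquareStabilizing.{u} S Kstar ∧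
      (∀ K, MJLS.JumpSystem.MeanSquareStabilizing.{u} S K → K ≠ Kstar →
        S.cost P ω x₀ Kstar < S.cost P ω x₀ K) ∧
      -- Gauss–Newton method
      (∀ η : ℝ, 0 < η → η ≤ 1 / 2 →
        0 ≤ 1 - 2 * η * MJLS.mu P ρ x₀ / MJLS.specNorm (S.chi P ω x₀ Kstar) ∧
        1 - 2 * η * MJLS.mu P ρ x₀ / MJLS.specNorm (S.chi P ω x₀ Kstar) < 1 ∧
        Tendsto (fun n => (S.gaussNewtonStep η)^[n] K₀) atTop (𝓝 Kstar) ∧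
        ∀ n : ℕ,
          MJLS.JumpSystem.MeanSquareStabilizing.{u} S ((S.gaussNewtonStep η)^[n] K₀) ∧
          S.costReal P ω x₀ ((S.gaussNewtonStep η)^[n] K₀) - S.costReal P ω x₀ Kstar ≤
            (1 - 2 * η * MJLS.mu P ρ x₀ / MJLS.specNorm (S.chi P ω x₀ Kstar)) ^ n *
              (S.costReal P ω x₀ K₀ - S.costReal P ω x₀ Kstar)) ∧
      -- natural policy gradient method
      (∀ η : ℝ, 0 < η →
        η ≤ 1 / (2 * (MJLS.specNorm (Matrix.blockDiagonal S.R)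
          + MJLS.specNorm (Matrix.blockDiagonal S.B) ^ 2 * S.costReal P ω x₀ K₀
            / MJLS.mu P ρ x₀)) →
        0 ≤ 1 - 2 * η * MJLS.mu P ρ x₀ * MJLS.sigmaMin (Matrix.blockDiagonal S.R)
          / MJLS.specNorm (S.chi P ω x₀ Kstar) ∧
        1 - 2 * η * MJLS.mu P ρ x₀ * MJLS.sigmaMin (Matrix.blockDiagonal S.R)
          / MJLS.specNorm (S.chi P ω x₀ Kstar) < 1 ∧
        Tendsto (fun n => (S.naturalGradientStep P ω x₀ η)^[n] K₀) atTop (𝓝 Kstar) ∧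
        ∀ n : ℕ,
          MJLS.JumpSystem.MeanSquareStabilizing.{u} S
            ((S.naturalGradientStep P ω x₀ η)^[n] K₀) ∧
          S.costReal P ω x₀ ((S.naturalGradientStep P ω x₀ η)^[n] K₀)
              - S.costReal P ω x₀ Kstar ≤
            (1 - 2 * η * MJLS.mu P ρ x₀ * MJLS.sigmaMin (Matrix.blockDiagonal S.R)
              / MJLS.specNorm (S.chi P ω x₀ Kstar)) ^ n *
              (S.costReal P ω x₀ K₀ - S.costReal P ω x₀ Kstar)) := by
  have hN : Nonempty (Fin N) := by
    by_contra hN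
    rw [not_nonempty_iff] at hN
    simp at hρ_sum
  have H : S.IsRegular P ω x₀ ρ := ⟨hN, ⟨⟨0, hd⟩⟩, ⟨⟨0, hk⟩⟩, hQ, hR, hp_nonneg, hp_sum, hρ_pos,
    inferInstance, hω, hx₀, hx₀_pos⟩
  simp only [H.meanSquareStabilizing_iff] at hK₀ ⊢
  obtain ⟨Kopt, hopt, hcrit⟩ := H.exists_critical hK₀
  have hPSD := H.posSemidef_lyapunov hopt
  have hgain : Kopt = S.riccatiGain (S.lyapunov Kopt) :=
    (MJLS.JumpSystem.factorOf_eq_zero_iff hp_nonneg hR hPSD).1 hcrit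
  refine ⟨fun K hK => ⟨?_, (H.hasGradientAt_costOfVec hK).differentiableAt,
    hK.existsUnique_lyapunov, H.summable_modeMoment hK, H.posDef_chiBlock hK⟩,
    S.lyapunov Kopt, Kopt, ?_, ?_, ?_, hgain, hopt, ?_, ?_, ?_⟩
  · rw [H.cost_eq hK]
    exact ENNReal.ofReal_ne_top
  · intro i
    rw [hopt.lyapunov_spec i, add_assoc]
    exact (hQ i).add_posSemidef (((hR i).posSemidef.transpose_mul_mul_same _).add
      ((MJLS.JumpSystem.posSemidef_nextMean hp_nonneg hPSD i).transpose_mul_mul_same _))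
  · rw [MJLS.JumpSystem.isRiccatiSolution_iff hp_nonneg hR hPSD, ← hgain]
    exact hopt.lyapunov_spec
  · intro Y' hY' hric
    have hY'' : ∀ i, (Y' i).PosSemidef := fun i => (hY' i).posSemidef
    have hlyap := (MJLS.JumpSystem.isRiccatiSolution_iff hp_nonneg hR hY'').1 hric
    have hst := H.isStable_of_isLyapunovSolution hY'' hlyap
    have hYeq := hst.lyapunov_eq hlyap
    have hcrit' : S.gradFactor (S.riccatiGain Y') = 0 := by
      have h := (MJLS.JumpSystem.factorOf_eq_zero_iff (S := S) hp_nonneg hR hY'').2 rfl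
      rw [← h]
      change S.factorOf (S.lyapunov (S.riccatiGain Y')) _ = _
      rw [hYeq]
    -- both gains are strict minimizers of the cost, so they agree
    have hKeq : S.riccatiGain Y' = Kopt := by
      by_contra hne
      exact lt_asymm (H.costReal_lt_of_ne hopt hcrit hst hne)
        (H.costReal_lt_of_ne hst hcrit' hopt (Ne.symm hne))
    rw [← hYeq, hKeq]
  · intro K hK hne
    have h := H.costReal_lt_of_ne hopt hcrit hK hne
    rw [H.costReal_eq hopt, H.costReal_eq hK] at h
    rw [H.cost_eq hopt, H.cost_eq hK]
    exact (ENNReal.ofReal_lt_ofReal_iff_of_nonneg (H.pairing_lyapunov_nonneg hopt)).2 h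
  · intro η hη hη1
    exact H.iterate_convergence hopt hcrit hK₀ (c := 2 * η) (by linarith) (by linarith)
      (S.gaussNewtonStep η) fun K hK _ => H.gaussNewton_sufficient_decrease hK hη.le hη1
  · intro η hη hη1
    have hβ := H.sigmaMin_R_le_add K₀
    have hσ := H.sigmaMin_R_pos
    set β := MJLS.specNorm (Matrix.blockDiagonal S.R)
      + MJLS.specNorm (Matrix.blockDiagonal S.B) ^ 2 * S.costReal P ω x₀ K₀ / MJLS.mu P ρ x₀
    set σ := MJLS.sigmaMin (Matrix.blockDiagonal S.R)
    have hηβ : 2 * η * β ≤ 1 := by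
      rw [le_div_iff₀ (by linarith)] at hη1
      linarith
    have hc1 : 2 * η * σ ≤ 1 :=
      (mul_le_mul_of_nonneg_left hβ (by linarith)).trans hηβ
    have h := H.iterate_convergence hopt hcrit hK₀ (c := 2 * η * σ) (by positivity) hc1
      (S.naturalGradientStep P ω x₀ η) fun K hK hle =>
        H.naturalGradient_sufficient_decrease hK hη.le hle hηβ
    rwa [mul_right_comm (2 * η) σ] at h
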